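/- **Setting.** Let $d\ge 1$ and $p\in[2,\infty)$. Let $\chi:\mathbb R^d\to[0,1]$ be a smooth radial function with $\chi(\xi)=1$ for $|\xi|\le 1$ and $\chi(\xi)=0$ for $|\xi|\ge 3/2$, put $\varphi(\xi)=\chi(\xi)-\chi(2\xi)$, and for a tempered distribution $f$ on $\mathbb R^d$ let $$\Delta_{-1}f=\mathscr F^{-1}\big(\chi(2\,\cdot)\,\mathscr Ff\big),\qquad \Delta_jf=\mathscr F^{-1}\big(\varphi(2^{-j}\cdot)\,\mathscr Ff\big)\quad(j\ge 0),$$ where $\mathscr F f(\xi)=(2\pi)^{-d/2}\int_{\mathbb R^d}e^{-i\xi\cdot x}f(x)\,dx$. Each $\Delta_jf$ is a smooth function. Let $\alpha\in(0,2)$, $c_0,\rho\in(0,1)$, $\Lambda\ge1$. Let $\nu$ be a symmetric Lévy measure on $\mathbb R^d$ (that is, $\nu(\{0\})=0$, $\int\min(1,|z|^2)\,\nu(dz)<\infty$, $\nu(-A)=\nu(A)$) such that $$\int_{B_r}\langle\theta,z\rangle^2\,\nu(dz)\ \ge\ c_0\,r^{2-\alpha}\qquad\text{for all } r\in(0,\rho)\text{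 and all unit vectors }\theta\in\mathbb R^d, \tag{1.1}$$ where $B_r=\{|z|<r\}$. Let $\sigma\in\mathbb R^{d\times d}$ be a constant matrix with $\Lambda^{-1}|\xi|\le|\sigma\xi|\le\Lambda|\xi|$ for all $\xi\in\mathbb R^d$, and $$L_\sigma u(x)=\int_{\mathbb R^d}\Big(u(x+\sigma z)-u(x)-\nabla u(x)\cdot\sigma z\,\mathbf 1_{B_1}(z)\Big)\,\nu(dz).$$ **Lemma 3.1 (Bernstein-type inequality for the nonlocal operator).** There are constants $c>0$ and $j_0\in\mathbb N$, depending only on $d,p,c_0,\rho$ and $\Lambda$, such that the following holds for all $\alpha,\chi,\nu,\sigma$ as above, every tempered distribution $f$ and every integer $j\ge-1$ for which $\Delta_jf$ is real-valued and belongs to $L^p(\mathbb R^d)$. The integral defining $L_\sigma\Delta_jf(x)$ converges absolutely for every $x$, the function $|\Delta_jf|^{p-2}\Delta_jf\,L_\sigma\Delta_jf$ is integrable on $\mathbb R^d$, and $$\int_{\mathbb R^d}|\Delta_jf|^{p-2}\,\Delta_jf\;L_\sigma\Delta_jf\,dx\ \le\ 0 .$$ If moreover $j\ge j_0$, then $$-\int_{\mathbb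 R^d}|\Delta_jf|^{p-2}\,\Delta_jf\;L_\sigma\Delta_jf\,dx\ \ge\ c\,2^{\alpha j}\,\|\Delta_jf\|_p^p .$$ -/

import Mathlib

open MeasureTheory
open scoped SchwartzMap ContDiff

noncomputable section

/-- `ℝ^d` with its Euclidean structure. -/
abbrev Rd (d : ℕ) : Type := EuclideanSpace ℝ (Fin d)

/-- A smooth radial cutoff `χ : ℝ^d → [0,1]` with `χ = 1` on `|ξ| ≤ 1` and `χ = 0` on
`|ξ| ≥ 3/2`. -/
structure IsRadialCutoff {d : ℕ} (χ : Rd d → ℝ) : Prop where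
  smooth : ContDiff ℝ ∞ χ
  mem_Icc : ∀ ξ, χ ξ ∈ Set.Icc (0 : ℝ) 1
  radial : ∀ ξ η : Rd d, ‖ξ‖ = ‖η‖ → χ ξ = χ η
  eq_one : ∀ ξ, ‖ξ‖ ≤ 1 → χ ξ = 1
  eq_zero : ∀ ξ, 3 / 2 ≤ ‖ξ‖ → χ ξ = 0

/-- The annular function `φ(ξ) = χ(ξ) - χ(2ξ)`. -/
def annular {d : ℕ} (χ : Rd d → ℝ) (ξ : Rd d) : ℝ :=
  χ ξ - χ ((2 : ℝ) • ξ)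

/-- The symbol of the `j`-th Littlewood-Paley block, as a function of the angular frequency `ξ`:
`χ(2ξ)` for `j = -1` and `φ(2^{-j} ξ)` for `j ≥ 0` (indices below `-1` are not used). -/
def dyadicSymbol {d : ℕ} (χ : Rd d → ℝ) (j : ℤ) (ξ : Rd d) : ℝ :=
  if j ≤ -1 then χ ((2 : ℝ) • ξ) else annular χ (((2 : ℝ) ^ (-j)) • ξ)

/-- The dyadic block `Δ_j` on tempered distributions: the Fourier multiplier with symbol
`dyadicSymbol χ j`. Mathlib's Fourier transform uses the character `e^{-2πi x·η}`, so that its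
frequency variable `η` corresponds to the angular frequency `ξ = 2πη` of `e^{-i x·ξ}`. -/
def dyadicBlock {d : ℕ} (χ : Rd d → ℝ) (j : ℤ) : 𝓢'(Rd d, ℂ) →L[ℂ] 𝓢'(Rd d, ℂ) :=
  TemperedDistribution.fourierMultiplierCLM ℂ
    (fun η : Rd d => ((dyadicSymbol χ j ((2 * Real.pi) • η) : ℝ) : ℂ))

/-- The tempered distribution `T` is the continuous real-valued function `u ∈ L^p(ℝ^d)`.
For `T = Δ_j f`, which is always a smooth function, `u` is that function. -/
structure IsContinuousLpFunction {d : ℕ} (T : 𝓢'(Rd d, ℂ)) (p : ℝ) (u : Rd d → ℝ) : Prop where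
  continuous : Continuous u
  memLp : MemLp u (ENNReal.ofReal p) volume
  apply_eq : ∀ g : 𝓢(Rd d, ℂ), T g = ∫ x, g x * (u x : ℂ)

/-- Lévy measures on `ℝ^d`. -/
structure IsLevyMeasure {d : ℕ} (ν : Measure (Rd d)) : Prop where
  zero : ν {0} = 0
  lintegral_lt_top : ∫⁻ z, ENNReal.ofReal (min 1 (‖z‖ ^ 2)) ∂ν < ⊤

/-- Invariance of `ν` under `z ↦ -z`. -/
def IsSymmetricMeasure {d : ℕ} (ν : Measure (Rd d)) : Prop :=
  ν.map (fun z => -z) = ν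

/-- The lower bound `∫_{B_r} ⟨θ, z⟩² ν(dz) ≥ c₀ r^{2-α}` for `r ∈ (0, ρ)` and unit vectors `θ`. -/
def LevyLowerBound {d : ℕ} (ν : Measure (Rd d)) (α c₀ ρ : ℝ) : Prop :=
  ∀ r ∈ Set.Ioo (0 : ℝ) ρ, ∀ θ : Rd d, ‖θ‖ = 1 →
    c₀ * r ^ (2 - α) ≤ ∫ z in Metric.ball 0 r, (inner ℝ θ z) ^ 2 ∂ν

/-- The integrand `u(x + σz) - u(x) - ∇u(x)·σz 1_{B_1}(z)`. -/
def levyIntegrand {d : ℕ} (σ : Rd d →L[ℝ] Rd d) (u : Rd d → ℝ) (x z : Rd d) : ℝ :=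
  u (x + σ z) - u x - (Metric.ball (0 : Rd d) 1).indicator (fun z => fderiv ℝ u x (σ z)) z

/-- The nonlocal operator `L_σ` with constant coefficient matrix `σ`. -/
def levyOp {d : ℕ} (ν : Measure (Rd d)) (σ : Rd d →L[ℝ] Rd d) (u : Rd d → ℝ) (x : Rd d) : ℝ :=
  ∫ z, levyIntegrand σ u x z ∂ν

/-- The integrand `|u|^{p-2} u L_σ u`. -/
def energyDensity {d : ℕ} (ν : Measure (Rd d)) (σ : Rd d →L[ℝ] Rd d) (p : ℝ) (u : Rd d → ℝ)
    (x : Rd d) : ℝ :=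
  |u x| ^ (p - 2) * u x * levyOp ν σ u x

end

/-! Write `φ(s) = |s|^{p-2} s`, `G(s) = |s|^{p/2-1} s`, `u = Δ_j f` and `v = G(u)`, so that
`‖v‖₂² = ‖u‖_p^p`.

The function `u` is reproduced by convolution with a Schwartz kernel (`eq_integral_lowPass`). Hence it
is bounded and differentiable, with second-order Taylor remainders controlled in `L^p`
(`exists_taylor_bound`), and all the integrals converge. Fubini's theorem, the symmetry of `ν` and
translation invariance give (`energy_identity`)
`-2 ∫ φ(u) L_σ u = ∫ E(σ z) ν(dz)`, where `E(h) = ∫ (φ(u(x+h)) - φ(u(x))) (u(x+h) - u(x)) dx ≥ 0`.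

For the lower bound, `E(h) ≥ c ‖v(· + h) - v‖₂²` (`sq_signedPow_sub_le`), and by Plancherel
`‖v(· + h) - v‖₂² = ∫ 4 sin² (π ⟨η, h⟩) dμ(η)` with the spectral measure `μ = |𝓕 v|² dη`
(`exists_spectral_measure`). On frequencies `|η| ≤ S 2^j` and jumps `|z| ≤ (2 Λ S 2^j)⁻¹` the sine is
comparable to its argument, so that the nondegeneracy of `ν` bounds the energy from below by
`2^{(α-2) j} ∫_{|η| ≤ S 2^j} |η|² dμ` (`le_lintegral_lintegral_sin_sq`).

It remains to see that `v` keeps a fixed part of its mass at frequencies of size `2^j`, although it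
is not band-limited (`exists_spectral_localisation`). At high frequencies `v` inherits from `u` the
Bernstein bound `‖v(· + h) - v‖₂ ≤ C 2^j |h| ‖v‖₂` (`halfPowerDifference_le`). At low frequencies one
uses that `G⁻¹` is Hölder continuous of exponent `2 / p`: since a low-pass filter `k` at scale
`2^j / 32` annihilates `u`, the norm `‖u‖_p^p` is at most the average of `‖u(· - y) - u‖_p^p` against
`|k(y)| dy`, hence of `‖v(· - y) - v‖₂²`
(`ofReal_integral_le_lintegral_halfPowerDifference`). Averaging `4 sin²` against `|k|` gives a
multiplier of size `min(1, 2^{-2j} |η|²)`, which is small at low frequencies. -/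

open FourierTransform Filter Topology

/-! ### Signed powers -/

/-- The odd extension `s ↦ |s| ^ (q - 1) * s` of the power `s ^ q` to the real line. -/
noncomputable def signedPow (q s : ℝ) : ℝ := |s| ^ (q - 1) * s

theorem signedPow_neg (q s : ℝ) : signedPow q (-s) = -signedPow q s := by
  simp [signedPow]

theorem signedPow_zero (q : ℝ) : signedPow q 0 = 0 := by simp [signedPow]

theorem signedPow_of_nonneg {q s : ℝ} (hq : 1 ≤ q) (hs : 0 ≤ s) : signedPow q s = s ^ q := by
  rcases hs.eq_or_lt with rfl | hs
  · rw [signedPow_zero, Real.zero_rpow (by linarith)]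
  · rw [signedPow, abs_of_pos hs, Real.rpow_sub_one hs.ne', div_mul_cancel₀ _ hs.ne']

theorem abs_signedPow {q : ℝ} (hq : 1 ≤ q) (s : ℝ) : |signedPow q s| = |s| ^ q := by
  rw [← signedPow_of_nonneg hq (abs_nonneg s), signedPow, signedPow, abs_mul, abs_abs,
    abs_of_nonneg (Real.rpow_nonneg (abs_nonneg s) _)]

theorem continuous_signedPow {q : ℝ} (hq : 1 ≤ q) : Continuous (signedPow q) := by
  unfold signedPow
  exact (continuous_abs.rpow_const fun _ => Or.inr (by linarith)).mul continuous_id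

theorem signedPow_sq {p : ℝ} (hp : 2 ≤ p) (s : ℝ) : signedPow (p / 2) s ^ 2 = |s| ^ p := by
  rw [← sq_abs, abs_signedPow (by linarith), ← Real.rpow_natCast, ← Real.rpow_mul (abs_nonneg _)]
  congr 1
  push_cast
  ring

/-- A property of two reals that is symmetric and invariant under simultaneous negation need only
be checked when `a` is nonnegative and dominates `|b|`. -/
theorem forall_of_abs_le {P : ℝ → ℝ → Prop} (hsymm : ∀ a b, P a b → P b a)
    (hneg : ∀ a b, P (-a) (-b) → P a b) (h : ∀ a b, |b| ≤ a → P a b) (a b : ℝ) : P a b := by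
  have key : ∀ a b : ℝ, |b| ≤ |a| → P a b := by
    intro a b hab
    rcases le_total 0 a with ha | ha
    · exact h a b (by rwa [abs_of_nonneg ha] at hab)
    · exact hneg a b (h _ _ (by rwa [abs_neg, ← abs_of_nonpos ha]))
  rcases le_total |b| |a| with hab | hab
  · exact key a b hab
  · exact hsymm _ _ (key b a hab)

/-- The increment of a signed power is at most the increment of the argument times the derivative
at the endpoint of larger modulus, up to a constant. -/
theorem signedPow_sub_le {q a b : ℝ} (hq : 1 ≤ q) (hab : |b| ≤ a) :
    0 ≤ signedPow q a - signedPow q b ∧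
      signedPow q a - signedPow q b ≤ (q + 2) * (a ^ (q - 1) * (a - b)) := by
  have ha : 0 ≤ a := (abs_nonneg b).trans hab
  have hmul : a ^ (q - 1) * a = a ^ q := by
    rw [← signedPow_of_nonneg hq ha, signedPow, abs_of_nonneg ha]
  have hpow : 0 ≤ a ^ (q - 1) := Real.rpow_nonneg ha _
  have hle : |b| ^ q ≤ a ^ q := Real.rpow_le_rpow (abs_nonneg _) hab (by linarith)
  have hb0 : 0 ≤ |b| ^ q := Real.rpow_nonneg (abs_nonneg b) q
  have hsub : 0 ≤ a - b := by linarith [le_abs_self b]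
  rw [signedPow_of_nonneg hq ha]
  rcases le_total 0 b with hb | hb
  · rw [abs_of_nonneg hb] at hle
    rw [signedPow_of_nonneg hq hb]
    refine ⟨by linarith, ?_⟩
    rcases ha.eq_or_lt with rfl | ha'
    · have : b = 0 := by rw [abs_of_nonneg hb] at hab; linarith
      subst this
      simp
    have hB := one_add_mul_self_le_rpow_one_add (s := b / a - 1) (p := q)
      (by have := div_nonneg hb ha; linarith) hq
    rw [add_sub_cancel, Real.div_rpow hb ha, le_div_iff₀ (Real.rpow_pos_of_pos ha' q)] at hB
    have h1 : (1 + q * (b / a - 1)) * a ^ q = a ^ q + q * (a ^ (q - 1) * (b - a)) := by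
      rw [← hmul]; field_simp
    have h2 : 0 ≤ a ^ (q - 1) * (a - b) := mul_nonneg hpow hsub
    nlinarith
  · have h1 : signedPow q b = -|b| ^ q := by
      rw [← neg_neg (signedPow q b), ← signedPow_neg, signedPow_of_nonneg hq (neg_nonneg.2 hb),
        abs_of_nonpos hb]
    rw [h1]
    refine ⟨by linarith, ?_⟩
    have h2 : a ^ (q - 1) * a ≤ a ^ (q - 1) * (a - b) :=
      mul_le_mul_of_nonneg_left (by linarith) hpow
    nlinarith [mul_nonneg hpow ha]

theorem rpow_mul_sq_le_signedPow_sub_mul {p a b : ℝ} (hp : 2 ≤ p) (hab : |b| ≤ a) :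
    a ^ (p - 2) * (a - b) ^ 2 ≤ 2 * ((signedPow (p - 1) a - signedPow (p - 1) b) * (a - b)) := by
  have ha : 0 ≤ a := (abs_nonneg b).trans hab
  have hpow : 0 ≤ a ^ (p - 2) := Real.rpow_nonneg ha _
  have hle : |b| ^ (p - 2) ≤ a ^ (p - 2) :=
    Real.rpow_le_rpow (abs_nonneg _) hab (by linarith)
  have hb0 : 0 ≤ |b| ^ (p - 2) := Real.rpow_nonneg (abs_nonneg b) _
  have hsub : 0 ≤ a - b := by linarith [le_abs_self b]
  have key : a ^ (p - 2) * (a - b) ≤ 2 * (signedPow (p - 1) a - signedPow (p - 1) b) := by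
    simp only [signedPow, abs_of_nonneg ha, show p - 1 - 1 = p - 2 by ring]
    rcases le_total 0 b with hb | hb
    · nlinarith [mul_le_mul_of_nonneg_right hle hb, mul_nonneg hpow hsub]
    · have h1 := neg_le_of_abs_le hab
      nlinarith [mul_le_mul_of_nonneg_left h1 hpow, mul_nonneg hb0 (neg_nonneg.2 hb)]
  nlinarith [mul_le_mul_of_nonneg_right key hsub]

/-- Coercivity of the `p`-form: `(|a|^{p-2}a - |b|^{p-2}b)(a - b)` controls the squared increment
of the half power `|s|^{p/2-1}s`. -/
theorem sq_signedPow_sub_le {p : ℝ} (hp : 2 ≤ p) (a b : ℝ) :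
    (signedPow (p / 2) a - signedPow (p / 2) b) ^ 2 ≤
      2 * (p / 2 + 2) ^ 2 * ((signedPow (p - 1) a - signedPow (p - 1) b) * (a - b)) := by
  revert a b
  refine forall_of_abs_le (fun a b h => ?_) (fun a b h => ?_) fun a b hab => ?_
  · linarith
  · simp only [signedPow_neg] at h
    linarith
  · have ha : 0 ≤ a := (abs_nonneg b).trans hab
    obtain ⟨h0, h1⟩ := signedPow_sub_le (q := p / 2) (by linarith) hab
    have h2 := rpow_mul_sq_le_signedPow_sub_mul hp hab
    have h3 := pow_le_pow_left₀ h0 h1 2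
    have h4 : (a ^ (p / 2 - 1)) ^ 2 = a ^ (p - 2) := by
      rw [← Real.rpow_natCast, ← Real.rpow_mul ha]; congr 1; push_cast; ring
    rw [mul_pow, mul_pow, h4] at h3
    nlinarith [sq_nonneg (p / 2 + 2)]

theorem signedPow_sub_mul_nonneg {p : ℝ} (hp : 2 ≤ p) (a b : ℝ) :
    0 ≤ (signedPow (p - 1) a - signedPow (p - 1) b) * (a - b) := by
  have h := (sq_nonneg _).trans (sq_signedPow_sub_le hp a b)
  have h2 : 0 < 2 * (p / 2 + 2) ^ 2 := by positivity
  exact nonneg_of_mul_nonneg_right h h2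

/-- The inverse of the half power is Hölder continuous of exponent `2 / p`. -/
theorem abs_sub_rpow_le {p : ℝ} (hp : 2 ≤ p) (a b : ℝ) :
    |a - b| ^ p ≤ 2 ^ p * (signedPow (p / 2) a - signedPow (p / 2) b) ^ 2 := by
  revert a b
  refine forall_of_abs_le (fun a b h => ?_) (fun a b h => ?_) fun a b hab => ?_
  · rwa [abs_sub_comm, ← neg_sub (signedPow _ a), neg_sq]
  · rw [← neg_sub' a b, abs_neg, signedPow_neg, signedPow_neg, ← neg_sub', neg_sq] at h
    exact h
  · have ha : 0 ≤ a := (abs_nonneg b).trans hab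
    have hsub : 0 ≤ a - b := by linarith [le_abs_self b]
    have hsq : ∀ x : ℝ, 0 ≤ x → (x ^ (p / 2)) ^ 2 = x ^ p := fun x hx => by
      rw [← Real.rpow_natCast, ← Real.rpow_mul hx]; congr 1; push_cast; ring
    rw [abs_of_nonneg hsub, signedPow_of_nonneg (by linarith) ha]
    rcases le_total 0 b with hb | hb
    · rw [signedPow_of_nonneg (by linarith) hb]
      have h1 := Real.add_rpow_le_rpow_add hsub hb (p := p / 2) (by linarith)
      rw [sub_add_cancel] at h1
      have h2 : 0 ≤ (a - b) ^ (p / 2) := Real.rpow_nonneg hsub _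
      have h3 := pow_le_pow_left₀ h2 (by linarith : _ ≤ a ^ (p / 2) - b ^ (p / 2)) 2
      rw [hsq _ hsub] at h3
      have h4 : (1 : ℝ) ≤ 2 ^ p := Real.one_le_rpow (by norm_num) (by linarith)
      nlinarith [sq_nonneg (a ^ (p / 2) - b ^ (p / 2))]
    · have h1 : (a - b) ^ p ≤ (2 * a) ^ p :=
        Real.rpow_le_rpow hsub (by linarith [neg_le_of_abs_le hab]) (by linarith)
      rw [Real.mul_rpow (by norm_num) ha] at h1
      refine h1.trans (mul_le_mul_of_nonneg_left ?_ (by positivity))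
      have h2 : signedPow (p / 2) b ≤ 0 := by
        rw [signedPow]
        exact mul_nonpos_of_nonneg_of_nonpos (Real.rpow_nonneg (abs_nonneg _) _) hb
      rw [← hsq a ha]
      exact pow_le_pow_left₀ (Real.rpow_nonneg ha _) (by linarith) 2

/-- The half power is Lipschitz on bounded sets; the weight `t` trades the size of the arguments
against the size of the increment. -/
theorem sq_signedPow_sub_le_weighted {p t : ℝ} (hp : 2 ≤ p) (ht : 0 < t) (a b : ℝ) :
    (signedPow (p / 2) a - signedPow (p / 2) b) ^ 2 ≤
      (p / 2 + 2) ^ 2 * t ^ 2 * (|a| ^ p + |b| ^ p + (t⁻¹ * |a - b|) ^ p) := by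
  revert a b
  refine forall_of_abs_le (fun a b h => ?_) (fun a b h => ?_) fun a b hab => ?_
  · rw [abs_sub_comm b a]
    linarith
  · rw [← neg_sub' a b, abs_neg, signedPow_neg, signedPow_neg, ← neg_sub', neg_sq, abs_neg,
      abs_neg] at h
    exact h
  · have ha : 0 ≤ a := (abs_nonneg b).trans hab
    have hsub : 0 ≤ a - b := by linarith [le_abs_self b]
    obtain ⟨h0, h1⟩ := signedPow_sub_le (q := p / 2) (by linarith) hab
    have h3 := pow_le_pow_left₀ h0 h1 2
    have h4 : (a ^ (p / 2 - 1)) ^ 2 = a ^ (p - 2) := by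
      rw [← Real.rpow_natCast, ← Real.rpow_mul ha]; congr 1; push_cast; ring
    rw [mul_pow, mul_pow, h4] at h3
    rw [abs_of_nonneg hsub, abs_of_nonneg ha]
    set B := t⁻¹ * (a - b) with hB
    have hB0 : 0 ≤ B := by positivity
    have hab' : a - b = t * B := by rw [hB]; field_simp
    have h5 : a ^ (p - 2) * B ^ 2 ≤ a ^ p + B ^ p := by
      have hsplit : ∀ x : ℝ, 0 ≤ x → x ^ (p - 2) * x ^ 2 = x ^ p := fun x hx => by
        rw [← Real.rpow_natCast, ← Real.rpow_add_of_nonneg hx (by linarith) (by norm_num)]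
        congr 1; push_cast; ring
      rcases le_total a B with h | h
      · have := mul_le_mul_of_nonneg_right
          (Real.rpow_le_rpow ha h (by linarith : 0 ≤ p - 2)) (sq_nonneg B)
        rw [hsplit B hB0] at this
        linarith [Real.rpow_nonneg ha p]
      · have := mul_le_mul_of_nonneg_left (pow_le_pow_left₀ hB0 h 2)
          (Real.rpow_nonneg ha (p - 2))
        rw [hsplit a ha] at this
        linarith [Real.rpow_nonneg hB0 p]
    have h6 : 0 ≤ |b| ^ p := Real.rpow_nonneg (abs_nonneg b) p
    calc _ ≤ _ := h3
      _ = (p / 2 + 2) ^ 2 * t ^ 2 * (a ^ (p - 2) * B ^ 2) := by rw [hab']; ring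
      _ ≤ _ := by
        apply mul_le_mul_of_nonneg_left _ (by positivity)
        linarith

/-- A crude form of Young's inequality. -/
theorem rpow_sub_one_mul_le {p a b : ℝ} (hp : 2 ≤ p) (ha : 0 ≤ a) (hb : 0 ≤ b) :
    a ^ (p - 1) * b ≤ a ^ p + b ^ p := by
  have hsplit : ∀ x : ℝ, 0 ≤ x → x ^ (p - 1) * x = x ^ p := fun x hx => by
    nth_rw 2 [← Real.rpow_one x]
    rw [← Real.rpow_add_of_nonneg hx (by linarith) (by norm_num)]
    congr 1; ring
  rcases le_total a b with h | h
  · have := mul_le_mul_of_nonneg_right (Real.rpow_le_rpow ha h (by linarith : 0 ≤ p - 1)) hb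
    rw [hsplit b hb] at this
    linarith [Real.rpow_nonneg ha p]
  · have := mul_le_mul_of_nonneg_left h (Real.rpow_nonneg ha (p - 1))
    rw [hsplit a ha] at this
    linarith [Real.rpow_nonneg hb p]

/-! ### Convolution with Schwartz kernels -/

/-- An integrable weight that dominates a Schwartz function together with its first differences and
second-order Taylor remainders for increments of norm at most `R`. -/
theorem SchwartzMap.exists_weight {E F : Type*} [NormedAddCommGroup E] [InnerProductSpace ℝ E]
    [FiniteDimensional ℝ E] [MeasurableSpace E] [BorelSpace E] [NormedAddCommGroup F]
    [NormedSpace ℝ F] (k : 𝓢(E, F)) {R : ℝ} (hR : 0 ≤ R) :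
    ∃ w : E → ℝ, Continuous w ∧ (∀ x, 0 ≤ w x) ∧ (∃ B, ∀ x, w x ≤ B) ∧ Integrable w ∧
      (∀ x, ‖fderiv ℝ k x‖ ≤ w x) ∧
      (∀ x h, ‖h‖ ≤ R → ‖k (x + h)‖ ≤ w x) ∧
      (∀ x h, ‖h‖ ≤ R → ‖k (x + h) - k x‖ ≤ ‖h‖ * w x) ∧
      (∀ x h, ‖h‖ ≤ R → ‖k (x + h) - k x - fderiv ℝ k x h‖ ≤ ‖h‖ ^ 2 * w x) := by
  set N := (volume : Measure E).integrablePower with hN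
  have hdec : ∀ n ≤ 2, ∃ C, ∀ x, (1 + ‖x‖) ^ N * ‖iteratedFDeriv ℝ n k x‖ ≤ C := fun n hn =>
    ⟨_, fun x => SchwartzMap.one_add_le_sup_seminorm_apply (𝕜 := ℝ) (m := (N, 2)) le_rfl hn k x⟩
  obtain ⟨C0, h0⟩ := hdec 0 (by norm_num)
  obtain ⟨C1, h1⟩ := hdec 1 (by norm_num)
  obtain ⟨C2, h2⟩ := hdec 2 le_rfl
  set C := max C0 (max C1 C2)
  have hC : 0 ≤ C := le_max_of_le_left ((by positivity : (0 : ℝ) ≤ _).trans (h0 0))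
  set w : E → ℝ := fun x => C * (1 + R) ^ N * (1 + ‖x‖) ^ (-(N : ℝ)) with hw
  have hwx : ∀ x, w x = C * (1 + R) ^ N / (1 + ‖x‖) ^ N := fun x => by
    rw [hw]; simp only
    rw [Real.rpow_neg (by positivity), Real.rpow_natCast, div_eq_mul_inv]
  have hshift : ∀ (a : ℝ) (x h : E), ‖h‖ ≤ R → (1 + ‖x + h‖) ^ N * a ≤ C → 0 ≤ a → a ≤ w x := by
    intro a x h hh ha ha0
    rw [hwx, le_div_iff₀ (by positivity)]
    have h1 : 1 + ‖x‖ ≤ (1 + R) * (1 + ‖x + h‖) := by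
      have : ‖x‖ ≤ ‖x + h‖ + ‖h‖ := by simpa using norm_sub_le (x + h) h
      nlinarith [norm_nonneg (x + h)]
    calc a * (1 + ‖x‖) ^ N ≤ a * ((1 + R) * (1 + ‖x + h‖)) ^ N := by gcongr
      _ = (1 + R) ^ N * ((1 + ‖x + h‖) ^ N * a) := by rw [mul_pow]; ring
      _ ≤ (1 + R) ^ N * C := by gcongr
      _ = _ := mul_comm _ _
  have hd0 : ∀ x h, ‖h‖ ≤ R → ‖k (x + h)‖ ≤ w x := fun x h hh =>
    hshift _ x h hh (by
      have := h0 (x + h)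
      rw [norm_iteratedFDeriv_zero] at this
      exact this.trans (le_max_left _ _)) (norm_nonneg _)
  have hd1 : ∀ x h, ‖h‖ ≤ R → ‖fderiv ℝ k (x + h)‖ ≤ w x := fun x h hh =>
    hshift _ x h hh (by
      have := h1 (x + h)
      rw [norm_iteratedFDeriv_one] at this
      exact this.trans ((le_max_left _ _).trans (le_max_right _ _))) (norm_nonneg _)
  have hd2 : ∀ x h, ‖h‖ ≤ R → ‖fderiv ℝ (fderiv ℝ k) (x + h)‖ ≤ w x := fun x h hh =>
    hshift _ x h hh (by
      have := h2 (x + h)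
      rw [← norm_iteratedFDeriv_fderiv, norm_iteratedFDeriv_one] at this
      exact this.trans ((le_max_right _ _).trans (le_max_right _ _)))
      (ContinuousLinearMap.opNorm_nonneg _)
  have hw0 : ∀ x, 0 ≤ w x := fun x => by rw [hwx]; positivity
  have hk : Differentiable ℝ k := k.differentiable
  have hk' : Differentiable ℝ (fderiv ℝ k) :=
    ((k.smooth 2).fderiv_right (m := 1) (by norm_num)).differentiable (by norm_num)
  have hball : ∀ x h y : E, ‖h‖ ≤ R → y ∈ Metric.closedBall x ‖h‖ → ∃ h', ‖h'‖ ≤ R ∧ y = x + h' :=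
    fun x h y hh hy => ⟨y - x, (by rw [← dist_eq_norm]; exact hy : ‖y - x‖ ≤ ‖h‖).trans hh, by simp⟩
  have hmem : ∀ x h : E, x + h ∈ Metric.closedBall x ‖h‖ := fun x h => by simp
  refine ⟨w, ?_, hw0, ⟨C * (1 + R) ^ N, fun x => ?_⟩, ?_, fun x => ?_, hd0, fun x h hh => ?_,
    fun x h hh => ?_⟩
  · simp_rw [hw]
    exact continuous_const.mul ((continuous_const.add continuous_norm).rpow_const
      fun x => Or.inl (add_pos_of_pos_of_nonneg one_pos (norm_nonneg x)).ne')
  · rw [hwx]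
    exact div_le_self (by positivity) (one_le_pow₀ (by linarith [norm_nonneg x]))
  · exact (Measure.integrable_pow_neg_integrablePower volume).const_mul _
  · simpa using hd1 x 0 (by simpa using hR)
  · have := (convex_closedBall x ‖h‖).norm_image_sub_le_of_norm_fderiv_le (𝕜 := ℝ) (f := k)
      (C := w x) (fun y _ => hk y) (fun y hy => by
        obtain ⟨h', hh', rfl⟩ := hball x h y hh hy
        exact hd1 x h' hh') (Metric.mem_closedBall_self (norm_nonneg h)) (hmem x h)
    rwa [add_sub_cancel_left, mul_comm] at this
  · have hfd : ∀ y ∈ Metric.closedBall x ‖h‖, ‖fderiv ℝ k y - fderiv ℝ k x‖ ≤ ‖h‖ * w x := by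
      intro y hy
      have := (convex_closedBall x ‖h‖).norm_image_sub_le_of_norm_fderiv_le (𝕜 := ℝ)
        (f := fderiv ℝ k) (C := w x) (fun y _ => hk' y) (fun y hy => by
          obtain ⟨h', hh', rfl⟩ := hball x h y hh hy
          exact hd2 x h' hh') (Metric.mem_closedBall_self (norm_nonneg h)) hy
      refine this.trans ?_
      rw [mul_comm]
      exact mul_le_mul_of_nonneg_right (by rw [← dist_eq_norm]; exact hy) (hw0 x)
    have := (convex_closedBall x ‖h‖).norm_image_sub_le_of_norm_fderiv_le' (𝕜 := ℝ) (f := k)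
      (φ := fderiv ℝ k x) (fun y _ => hk y) hfd (Metric.mem_closedBall_self (norm_nonneg h))
      (hmem x h)
    rw [add_sub_cancel_left] at this
    exact this.trans_eq (by ring)

section Kernel

variable {E : Type*} [NormedAddCommGroup E] [InnerProductSpace ℝ E] [FiniteDimensional ℝ E]
  [MeasurableSpace E] [BorelSpace E]

theorem abs_le_one_add_rpow {p : ℝ} (hp : 2 ≤ p) (a : ℝ) : |a| ≤ 1 + |a| ^ p := by
  have h0 := Real.rpow_nonneg (abs_nonneg a) p
  rcases le_total |a| 1 with h | h
  · linarith
  · have := Real.rpow_le_rpow_of_exponent_le h (by linarith : (1 : ℝ) ≤ p)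
    rw [Real.rpow_one] at this
    linarith

/-- A bounded integrable weight times a translated `L^p` function is integrable. -/
theorem integrable_weight_mul {p : ℝ} (hp : 2 ≤ p) {u : E → ℝ} (hu : Continuous u)
    (hup : Integrable fun x => |u x| ^ p) {w : E → ℝ} (hw : Continuous w) (hw0 : ∀ x, 0 ≤ w x)
    {B : ℝ} (hB : ∀ x, w x ≤ B) (hwi : Integrable w) (x : E) :
    Integrable (fun y => w y * |u (x - y)|) ∧
      ∫ y, w y * |u (x - y)| ≤ (∫ y, w y) + B * ∫ y, |u y| ^ p := by
  have hpt : ∀ y, w y * |u (x - y)| ≤ w y + B * |u (x - y)| ^ p := fun y => by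
    have h1 := mul_le_mul_of_nonneg_left (abs_le_one_add_rpow hp (u (x - y))) (hw0 y)
    have h2 := mul_le_mul_of_nonneg_right (hB y) (Real.rpow_nonneg (abs_nonneg (u (x - y))) p)
    linarith
  have hi : Integrable fun y => w y + B * |u (x - y)| ^ p :=
    hwi.add ((hup.comp_sub_left x).const_mul B)
  have hi' : Integrable (fun y => w y * |u (x - y)|) := by
    refine hi.mono' (by fun_prop) (ae_of_all _ fun y => ?_)
    rw [Real.norm_of_nonneg (mul_nonneg (hw0 y) (abs_nonneg _))]
    exact hpt y
  refine ⟨hi', (integral_mono hi' hi hpt).trans_eq ?_⟩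
  rw [integral_add hwi ((hup.comp_sub_left x).const_mul B), integral_const_mul,
    integral_sub_left_eq_self (fun y => |u y| ^ p)]

theorem integrable_schwartz_mul {p : ℝ} (hp : 2 ≤ p) {u : E → ℝ} (hu : Continuous u)
    (hup : Integrable fun x => |u x| ^ p) (K : 𝓢(E, ℂ)) (x : E) :
    Integrable fun y => K y * (u (x - y) : ℂ) := by
  obtain ⟨w, hw, hw0, ⟨B, hB⟩, hwi, -, hk, -, -⟩ := K.exists_weight le_rfl
  refine (integrable_weight_mul hp hu hup hw hw0 hB hwi x).1.mono' (by fun_prop)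
    (ae_of_all _ fun y => ?_)
  rw [norm_mul, Complex.norm_real, Real.norm_eq_abs]
  gcongr
  simpa using hk y 0 (by simp)

theorem continuous_schwartz_conv {p : ℝ} (hp : 2 ≤ p) {u : E → ℝ} (hu : Continuous u)
    (hup : Integrable fun x => |u x| ^ p) (K : 𝓢(E, ℂ)) :
    Continuous fun x => ∫ y, K y * (u (x - y) : ℂ) := by
  have hsub : ∀ x, ∫ y, K y * (u (x - y) : ℂ) = ∫ y, K (x - y) * (u y : ℂ) := fun x => by
    rw [← integral_sub_left_eq_self _ volume x]
    simp
  simp_rw [hsub]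
  obtain ⟨w, hw, hw0, ⟨B, hB⟩, hwi, -, hk, -, -⟩ := K.exists_weight zero_le_one
  refine continuous_iff_continuousAt.2 fun x => ?_
  refine continuousAt_of_dominated (bound := fun y => w (x - y) * |u y|)
    (Eventually.of_forall fun x => by fun_prop) ?_ ?_
    (ae_of_all _ fun y => by fun_prop)
  · filter_upwards [Metric.closedBall_mem_nhds x one_pos] with x' hx'
    refine ae_of_all _ fun y => ?_
    rw [norm_mul, Complex.norm_real, Real.norm_eq_abs]
    gcongr
    have := hk (x - y) (x' - x) (by rw [← dist_eq_norm]; exact hx')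
    rwa [show x - y + (x' - x) = x' - y by abel] at this
  · have := (integrable_weight_mul hp hu hup hw hw0 hB hwi x).1.comp_sub_left x
    simpa using this

/-- The transpose of a Fourier multiplier with Schwartz symbol is correlation with the inverse
Fourier transform of the symbol. -/
theorem fourier_smulLeft_fourierInv_apply (B g : 𝓢(E, ℂ)) (y : E) :
    𝓕 (SchwartzMap.smulLeftCLM ℂ (B : E → ℂ) (𝓕⁻ g)) y = ∫ t, (𝓕⁻ B) t * g (y + t) := by
  set gn : 𝓢(E, ℂ) :=
    SchwartzMap.compCLMOfContinuousLinearEquiv ℂ (LinearIsometryEquiv.neg ℝ (E := E)) g with hgn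
  have hgn' : ∀ x, gn x = g (-x) := fun x => rfl
  have hF : 𝓕 gn = 𝓕⁻ g := by
    ext x
    rw [SchwartzMap.fourier_coe, SchwartzMap.fourierInv_coe]
    have : (gn : E → ℂ) = fun x => g (-x) := rfl
    rw [this, Real.fourierInv_eq_fourier_comp_neg]
  have hconv := SchwartzMap.convolution_apply (ContinuousLinearMap.mul ℂ ℂ) (𝓕⁻ B) gn (-y)
  have hdef : SchwartzMap.convolution (ContinuousLinearMap.mul ℂ ℂ) (𝓕⁻ B) gn =
      𝓕⁻ (SchwartzMap.smulLeftCLM ℂ (B : E → ℂ) (𝓕⁻ g)) := by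
    rw [← fourierInv_fourier_eq (F := 𝓢(E, ℂ)) (SchwartzMap.convolution _ (𝓕⁻ B) gn),
      SchwartzMap.fourier_convolution, hF, fourier_fourierInv_eq]
    congr 1
    ext x
    simp [SchwartzMap.pairing_apply_apply, SchwartzMap.smulLeftCLM_apply_apply B.hasTemperateGrowth]
  rw [hdef, SchwartzMap.fourierInv_coe, Real.fourierInv_eq_fourier_neg, neg_neg] at hconv
  rw [SchwartzMap.fourier_coe, hconv, convolution_def]
  refine integral_congr_ae (ae_of_all _ fun t => ?_)
  simp only [ContinuousLinearMap.mul_apply', hgn']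
  congr 2
  abel

/-- If the tempered distribution `T` is the `L^p` function `u`, the Fourier multiplier with Schwartz
symbol `B` maps it to the convolution of `u` with the inverse Fourier transform of `B`. -/
theorem fourierMultiplier_apply_eq_integral {p : ℝ} (hp : 2 ≤ p) {u : E → ℝ} (hu : Continuous u)
    (hup : Integrable fun x => |u x| ^ p) {T : 𝓢'(E, ℂ)}
    (hT : ∀ g : 𝓢(E, ℂ), T g = ∫ x, g x * (u x : ℂ)) (B g : 𝓢(E, ℂ)) :
    TemperedDistribution.fourierMultiplierCLM ℂ (B : E → ℂ) T g =
      ∫ x, g x * ∫ y, (𝓕⁻ B) y * (u (x - y) : ℂ) := by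
  set K := 𝓕⁻ B
  rw [TemperedDistribution.fourierMultiplierCLM_apply_apply, hT]
  simp_rw [fourier_smulLeft_fourierInv_apply]
  have hint : Integrable (fun z : E × E => K z.2 * g z.1 * (u (z.1 - z.2) : ℂ))
      (volume.prod volume) := by
    obtain ⟨Cg, hCg⟩ : ∃ C, ∀ x, ‖g x‖ ≤ C := ⟨_, fun x => SchwartzMap.norm_le_seminorm ℝ g x⟩
    have h1 : Integrable (fun z : E × E => ‖g z.1‖ * ‖K z.2‖) (volume.prod volume) :=
      g.integrable.norm.mul_prod K.integrable.norm
    have h2 : Integrable (fun z : E × E => ‖K z.2‖ * |u (z.1 - z.2)| ^ p) (volume.prod volume) := by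
      simpa using K.integrable.norm.convolution_integrand (ContinuousLinearMap.mul ℝ ℝ) hup
    refine (h1.add (h2.const_mul Cg)).mono' (by fun_prop) (ae_of_all _ fun z => ?_)
    rw [norm_mul, norm_mul, Complex.norm_real, Real.norm_eq_abs]
    have h3 := abs_le_one_add_rpow hp (u (z.1 - z.2))
    have h4 : 0 ≤ |u (z.1 - z.2)| ^ p := by positivity
    calc ‖K z.2‖ * ‖g z.1‖ * |u (z.1 - z.2)|
        ≤ ‖K z.2‖ * ‖g z.1‖ * (1 + |u (z.1 - z.2)| ^ p) := by gcongr
      _ = ‖g z.1‖ * ‖K z.2‖ + ‖g z.1‖ * (‖K z.2‖ * |u (z.1 - z.2)| ^ p) := by ring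
      _ ≤ ‖g z.1‖ * ‖K z.2‖ + Cg * (‖K z.2‖ * |u (z.1 - z.2)| ^ p) := by gcongr; exact hCg _
  have hR : ∫ x, g x * ∫ y, K y * (u (x - y) : ℂ) =
      ∫ y, ∫ x, K y * g x * (u (x - y) : ℂ) := by
    rw [integral_integral_swap (f := fun y x => K y * g x * (u (x - y) : ℂ)) hint.swap]
    refine integral_congr_ae (ae_of_all _ fun x => ?_)
    simp only
    rw [← integral_const_mul]
    exact integral_congr_ae (ae_of_all _ fun y => by simp only; ring)
  have hshear : Integrable (fun z : E × E => K z.2 * g (z.1 + z.2) * (u z.1 : ℂ))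
      (volume.prod volume) := by
    have := (measurePreserving_add_prod (volume : Measure E) (volume : Measure E)).integrable_comp_of_integrable
      hint
    simpa [Function.comp_def] using this
  rw [hR]
  have h5 : ∀ y, ∫ x, K y * g x * (u (x - y) : ℂ) = ∫ x, K y * g (x + y) * (u x : ℂ) := fun y => by
    rw [← integral_add_right_eq_self _ y]
    simp
  simp_rw [h5]
  rw [integral_integral_swap (f := fun y x => K y * g (x + y) * (u x : ℂ)) hshear.swap]
  exact integral_congr_ae (ae_of_all _ fun x => by simp only; rw [← integral_mul_const])

/-- Two continuous functions that agree as distributions agree pointwise. -/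
theorem eq_of_integral_schwartz_mul_eq {a b : E → ℂ} (ha : Continuous a) (hb : Continuous b)
    (h : ∀ g : 𝓢(E, ℂ), Integrable (fun x => g x * a x) → Integrable (fun x => g x * b x) →
      ∫ x, g x * a x = ∫ x, g x * b x) : a = b := by
  have hae : ∀ᵐ x ∂(volume : Measure E), (a - b) x = 0 := by
    refine ae_eq_zero_of_integral_contDiff_smul_eq_zero (ha.sub hb).locallyIntegrable
      fun g hg hgc => ?_
    have hg₁ : HasCompactSupport (Complex.ofRealCLM ∘ g) := hgc.comp_left rfl
    have hg₂ : ContDiff ℝ ∞ (Complex.ofRealCLM ∘ g) := by fun_prop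
    have hi : ∀ c : E → ℂ, Continuous c → Integrable fun x => (g x : ℂ) * c x := fun c hc => by
      have hc' : Continuous fun x => (g x : ℂ) * c x := by
        have := hg.continuous
        fun_prop
      exact hc'.integrable_of_hasCompactSupport (hg₁.mul_right (f' := c))
    have := h (hg₁.toSchwartzMap hg₂) (by simpa using hi a ha) (by simpa using hi b hb)
    simp only [HasCompactSupport.toSchwartzMap_toFun, Function.comp_apply,
      Complex.ofRealCLM_apply] at this
    simp only [Pi.sub_apply, Complex.real_smul, mul_sub]
    rw [integral_sub (hi a ha) (hi b hb), this, sub_self]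
  have : a - b = 0 := (Continuous.ae_eq_iff_eq volume (ha.sub hb) continuous_const).1 hae
  exact sub_eq_zero.1 this

end Kernel

/-! ### Low-pass kernels and reproducing formulas -/

section LowPass

variable {E : Type*} [NormedAddCommGroup E] [InnerProductSpace ℝ E] [FiniteDimensional ℝ E]
  [MeasurableSpace E] [BorelSpace E]

/-- The real-valued kernel `k` is the convolution kernel of a low-pass filter: its Fourier transform
`B` is one on the ball of radius `s` and vanishes outside the ball of radius `2 s`. The constants
`A₀`, `A₁`, `A₂` bound its mass, its smoothness and its second moment uniformly in `s`. -/
structure IsLowPass (A₀ A₁ A₂ s : ℝ) (B : 𝓢(E, ℂ)) (k : 𝓢(E, ℝ)) : Prop where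
  eq_re : ∀ y, k y = ((𝓕⁻ B : 𝓢(E, ℂ)) y).re
  eq_one : ∀ η, ‖η‖ ≤ s → B η = 1
  eq_zero : ∀ η, 2 * s ≤ ‖η‖ → B η = 0
  mass : ∫ y, |k y| ≤ A₀
  smoothness : ∀ h, ∫ y, |k (y + h) - k y| ≤ A₁ * (s * ‖h‖)
  integrable_moment : Integrable fun y => |k y| * ‖y‖ ^ 2
  moment : ∫ y, |k y| * ‖y‖ ^ 2 ≤ A₂ / s ^ 2

theorem fourierInv_comp_inv_smul {s : ℝ} (hs : 0 < s) (f : E → ℂ) (y : E) :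
    𝓕⁻ (fun η => f (s⁻¹ • η)) y = (s ^ Module.finrank ℝ E : ℝ) • 𝓕⁻ f (s • y) := by
  rw [Real.fourierInv_eq, Real.fourierInv_eq]
  have h := Measure.integral_comp_inv_smul volume
    (fun η : E => Real.fourierChar (inner ℝ η (s • y)) • f η) s
  rw [abs_of_pos (by positivity)] at h
  rw [← h]
  refine integral_congr_ae (ae_of_all _ fun η => ?_)
  simp only [inner_smul_left, inner_smul_right]
  congr 3
  simp [hs.ne']

theorem integral_abs_schwartz_diff_le (k : 𝓢(E, ℝ)) :
    ∃ A, 0 ≤ A ∧ ∀ h, ∫ y, |k (y + h) - k y| ≤ A * ‖h‖ := by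
  obtain ⟨w, hw, hw0, -, hwi, -, -, hd, -⟩ := k.exists_weight zero_le_one
  have hk := k.integrable (μ := volume)
  have hI : 0 ≤ ∫ y, w y := integral_nonneg hw0
  have hJ : 0 ≤ ∫ y, |k y| := integral_nonneg fun y => abs_nonneg _
  refine ⟨(∫ y, w y) + 2 * ∫ y, |k y|, by positivity, fun h => ?_⟩
  have hint : Integrable fun y => |k (y + h) - k y| := ((hk.comp_add_right h).sub hk).norm
  rcases le_total ‖h‖ 1 with h1 | h1
  · calc ∫ y, |k (y + h) - k y| ≤ ∫ y, ‖h‖ * w y :=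
          integral_mono hint (hwi.const_mul _) fun y => hd y h h1
      _ = (∫ y, w y) * ‖h‖ := by rw [integral_const_mul, mul_comm]
      _ ≤ _ := by gcongr; linarith
  · calc ∫ y, |k (y + h) - k y| ≤ ∫ y, (|k (y + h)| + |k y|) :=
          integral_mono hint ((hk.comp_add_right h).norm.add hk.norm) fun y => abs_sub _ _
      _ = 2 * ∫ y, |k y| := by
          simp only [← Real.norm_eq_abs]
          rw [integral_add (hk.comp_add_right h).norm hk.norm,
            integral_add_right_eq_self (fun y => ‖k y‖) h]
          ring
      _ ≤ (2 * ∫ y, |k y|) * ‖h‖ := le_mul_of_one_le_right (by positivity) h1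
      _ ≤ _ := by gcongr; linarith

variable (E) in
/-- Low-pass kernels exist at every scale, with uniform constants: they are dilates of one another. -/
theorem exists_isLowPass : ∃ A₀ A₁ A₂ : ℝ, 0 ≤ A₀ ∧ 0 ≤ A₁ ∧ 0 ≤ A₂ ∧ ∀ s : ℝ, 0 < s →
    ∃ (B : 𝓢(E, ℂ)) (k : 𝓢(E, ℝ)), IsLowPass A₀ A₁ A₂ s B k := by
  let b : ContDiffBump (0 : E) := ⟨1, 2, by norm_num, by norm_num⟩
  have hb1 : ∀ η, ‖η‖ ≤ 1 → b η = 1 := fun η h => b.one_of_mem_closedBall (by simpa using h)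
  have hb0 : ∀ η, 2 ≤ ‖η‖ → b η = 0 := fun η h => b.zero_of_le_dist (by simpa using h)
  have hS : ∀ s : ℝ, 0 < s → ∃ B : 𝓢(E, ℂ), ∀ η, B η = (b (s⁻¹ • η) : ℂ) := fun s hs => by
    have h1 : HasCompactSupport fun η => (b (s⁻¹ • η) : ℂ) := by
      have := (b.hasCompactSupport.comp_smul (inv_ne_zero hs.ne')).comp_left
        (g := Complex.ofReal) Complex.ofReal_zero
      exact this
    have h2 : ContDiff ℝ ∞ fun η => (b (s⁻¹ • η) : ℂ) :=
      Complex.ofRealCLM.contDiff.comp (b.contDiff.comp (contDiff_const_smul _))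
    exact ⟨h1.toSchwartzMap h2, fun η => rfl⟩
  obtain ⟨B₁, hB₁⟩ := hS 1 one_pos
  set k₁ : 𝓢(E, ℝ) := (𝓕⁻ B₁).postcompCLM Complex.reCLM with hk₁
  obtain ⟨A₁, hA₁, hdiff⟩ := integral_abs_schwartz_diff_le k₁
  refine ⟨∫ y, |k₁ y|, A₁, ∫ y, |k₁ y| * ‖y‖ ^ 2, integral_nonneg fun y => abs_nonneg _, hA₁,
    integral_nonneg fun y => by positivity, fun s hs => ?_⟩
  obtain ⟨B, hB⟩ := hS s hs
  set n := Module.finrank ℝ E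
  have hsn : 0 < s ^ n := by positivity
  set k : 𝓢(E, ℝ) := (𝓕⁻ B).postcompCLM Complex.reCLM with hk
  have hks : ∀ y, k y = s ^ n * k₁ (s • y) := fun y => by
    have : (B : E → ℂ) = fun η => B₁ (s⁻¹ • η) := by
      ext η
      rw [hB, hB₁, inv_one, one_smul]
    simp only [hk, hk₁, SchwartzMap.postcompCLM_apply, SchwartzMap.fourierInv_coe]
    rw [this, fourierInv_comp_inv_smul hs, Complex.real_smul]
    exact Complex.re_ofReal_mul _ _
  have hscale : ∀ F : E → ℝ, ∫ y, s ^ n * F (s • y) = ∫ y, F y := fun F => by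
    rw [integral_const_mul, Measure.integral_comp_smul, abs_of_pos (by positivity), smul_eq_mul,
      mul_inv_cancel_left₀ hsn.ne']
  have hmom : (fun y => |k y| * ‖y‖ ^ 2) =
      fun y => (s ^ 2)⁻¹ * (s ^ n * (|k₁ (s • y)| * ‖s • y‖ ^ 2)) := by
    ext y
    rw [hks, abs_mul, abs_of_pos hsn, norm_smul, Real.norm_of_nonneg hs.le]
    field_simp
  refine ⟨B, k, fun y => rfl, fun η hη => ?_, fun η hη => ?_, le_of_eq ?_, fun h => ?_, ?_,
    le_of_eq ?_⟩
  · rw [hB, hb1, Complex.ofReal_one]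
    rw [norm_smul, norm_inv, Real.norm_of_nonneg hs.le, inv_mul_le_iff₀ hs]
    linarith
  · rw [hB, hb0, Complex.ofReal_zero]
    rw [norm_smul, norm_inv, Real.norm_of_nonneg hs.le, le_inv_mul_iff₀ hs]
    linarith
  · rw [← hscale fun y => |k₁ y|]
    simp_rw [hks, abs_mul, abs_of_pos hsn]
  · have : ∀ y, |k (y + h) - k y| = s ^ n * |k₁ (s • y + s • h) - k₁ (s • y)| := fun y => by
      rw [hks, hks, ← mul_sub, abs_mul, abs_of_pos hsn, smul_add]
    simp_rw [this]
    rw [hscale fun y => |k₁ (y + s • h) - k₁ y|]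
    refine (hdiff (s • h)).trans_eq ?_
    rw [norm_smul, Real.norm_of_nonneg hs.le]
  · rw [hmom]
    have h1 : Integrable fun y => |k₁ y| * ‖y‖ ^ 2 := by
      simpa [mul_comm] using k₁.integrable_pow_mul volume 2
    exact ((h1.comp_smul hs.ne').const_mul _).const_mul _
  · rw [hmom, integral_const_mul, hscale fun y => |k₁ y| * ‖y‖ ^ 2]
    field_simp

namespace IsLowPass

variable {A₀ A₁ A₂ s : ℝ} {B : 𝓢(E, ℂ)} {k : 𝓢(E, ℝ)}

theorem integral_mul_cos (hk : IsLowPass A₀ A₁ A₂ s B k) (η : E) :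
    ∫ y, k y * Real.cos (2 * Real.pi * inner ℝ η y) = ((B η + B (-η)) / 2).re := by
  have hB : ∀ η, B η = ∫ y, Complex.exp (↑(-2 * Real.pi * inner ℝ y η) * Complex.I) •
      (𝓕⁻ B : 𝓢(E, ℂ)) y := fun η => by
    rw [← Real.fourier_eq', ← SchwartzMap.fourier_coe, fourier_fourierInv_eq]
  have hint : ∀ η, Integrable fun y => Complex.exp (↑(-2 * Real.pi * inner ℝ y η) * Complex.I) •
      (𝓕⁻ B : 𝓢(E, ℂ)) y := fun η => by
    refine (𝓕⁻ B : 𝓢(E, ℂ)).integrable.mono (by fun_prop) (ae_of_all _ fun y => ?_)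
    rw [norm_smul, Complex.norm_exp_ofReal_mul_I, one_mul]
  rw [hB η, hB (-η), ← integral_add (hint η) (hint (-η)), ← integral_div, ← RCLike.re_eq_complex_re,
    ← integral_re (f := fun y => (Complex.exp (↑(-2 * Real.pi * inner ℝ y η) * Complex.I) •
      (𝓕⁻ B : 𝓢(E, ℂ)) y + Complex.exp (↑(-2 * Real.pi * inner ℝ y (-η)) * Complex.I) •
      (𝓕⁻ B : 𝓢(E, ℂ)) y) / 2) (((hint η).add (hint (-η))).div_const 2)]
  refine integral_congr_ae (ae_of_all _ fun y => ?_)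
  simp only [inner_neg_right, smul_eq_mul, ← add_mul]
  have : Complex.exp (↑(-2 * Real.pi * inner ℝ y η) * Complex.I) +
      Complex.exp (↑(-2 * Real.pi * -inner ℝ y η) * Complex.I) =
      ((2 * Real.cos (2 * Real.pi * inner ℝ η y) : ℝ) : ℂ) := by
    rw [real_inner_comm, Complex.ofReal_mul 2 (Real.cos _), Complex.ofReal_cos, Complex.cos]
    push_cast
    ring_nf
  rw [this, RCLike.re_eq_complex_re, mul_div_assoc, Complex.re_ofReal_mul, hk.eq_re]
  simp only [Complex.div_ofNat_re]
  ring

theorem integral_eq_one (hs : 0 < s) (hk : IsLowPass A₀ A₁ A₂ s B k) : ∫ y, k y = 1 := by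
  have := hk.integral_mul_cos 0
  simpa [hk.eq_one 0 (by simpa using hs.le)] using this

/-- Frequencies beyond the pass band are detected by the second differences that the kernel
averages. -/
theorem integral_mul_sin_sq (hs : 0 < s) (hk : IsLowPass A₀ A₁ A₂ s B k) {η : E}
    (hη : 2 * s ≤ ‖η‖) : ∫ y, k y * (4 * Real.sin (Real.pi * inner ℝ η y) ^ 2) = 2 := by
  have h1 := hk.integral_mul_cos η
  rw [hk.eq_zero η hη, hk.eq_zero (-η) (by rwa [norm_neg])] at h1
  have h2 : ∀ y, k y * (4 * Real.sin (Real.pi * inner ℝ η y) ^ 2) =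
      2 * k y - 2 * (k y * Real.cos (2 * Real.pi * inner ℝ η y)) := fun y => by
    rw [Real.sin_sq_eq_half_sub, ← mul_assoc 2 Real.pi]
    ring
  have hi : Integrable fun y => k y * Real.cos (2 * Real.pi * inner ℝ η y) := by
    refine (k.integrable (μ := volume)).mono (by fun_prop) (ae_of_all _ fun y => ?_)
    rw [norm_mul]
    exact mul_le_of_le_one_right (norm_nonneg _) (Real.abs_cos_le_one _)
  simp_rw [h2]
  rw [integral_sub (k.integrable.const_mul 2) (hi.const_mul 2), integral_const_mul,
    integral_const_mul, h1, hk.integral_eq_one hs]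
  simp

end IsLowPass

end LowPass

section Block

variable {d : ℕ}

theorem dyadicSymbol_eq_zero_of_le {χ : Rd d → ℝ} (hχ : IsRadialCutoff χ) {j : ℤ} (hj : -1 ≤ j)
    {ξ : Rd d} (hξ : 3 / 2 * (2 : ℝ) ^ j ≤ ‖ξ‖) : dyadicSymbol χ j ξ = 0 := by
  have h2 : (0 : ℝ) < 2 ^ j := by positivity
  rw [dyadicSymbol]
  split_ifs with h
  · obtain rfl : j = -1 := le_antisymm h hj
    apply hχ.eq_zero
    rw [norm_smul, Real.norm_of_nonneg zero_le_two]
    rw [zpow_neg_one] at hξ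
    linarith
  · have h3 : 3 / 2 ≤ ‖(2 : ℝ) ^ (-j) • ξ‖ := by
      rw [norm_smul, Real.norm_of_nonneg (by positivity), zpow_neg, le_inv_mul_iff₀ h2]
      linarith
    rw [annular, hχ.eq_zero _ h3, hχ.eq_zero, sub_zero]
    rw [norm_smul, Real.norm_of_nonneg zero_le_two]
    linarith

theorem dyadicSymbol_eq_zero_of_ge {χ : Rd d → ℝ} (hχ : IsRadialCutoff χ) {j : ℤ} (hj : 0 ≤ j)
    {ξ : Rd d} (hξ : ‖ξ‖ ≤ 1 / 2 * (2 : ℝ) ^ j) : dyadicSymbol χ j ξ = 0 := by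
  have h2 : (0 : ℝ) < 2 ^ j := by positivity
  have h3 : ‖(2 : ℝ) ^ (-j) • ξ‖ ≤ 1 / 2 := by
    rw [norm_smul, Real.norm_of_nonneg (by positivity), zpow_neg, inv_mul_le_iff₀ h2]
    linarith
  rw [dyadicSymbol, if_neg (by omega), annular, hχ.eq_one _ (by linarith), hχ.eq_one, sub_self]
  rw [norm_smul, Real.norm_of_nonneg zero_le_two]
  linarith

theorem hasTemperateGrowth_dyadicSymbol {χ : Rd d → ℝ} (hχ : IsRadialCutoff χ) {j : ℤ}
    (hj : -1 ≤ j) :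
    (fun η : Rd d => ((dyadicSymbol χ j ((2 * Real.pi) • η) : ℝ) : ℂ)).HasTemperateGrowth := by
  have h1 : HasCompactSupport fun η : Rd d => ((dyadicSymbol χ j ((2 * Real.pi) • η) : ℝ) : ℂ) := by
    refine HasCompactSupport.of_support_subset_isCompact
      (isCompact_closedBall (0 : Rd d) (3 / 2 * (2 : ℝ) ^ j)) fun η hη => ?_
    rw [mem_closedBall_zero_iff]
    by_contra! h
    refine hη ?_
    simp only
    rw [dyadicSymbol_eq_zero_of_le hχ hj, Complex.ofReal_zero]
    rw [norm_smul, Real.norm_of_nonneg (by positivity)]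
    nlinarith [Real.pi_gt_three, norm_nonneg η]
  have h2 : ContDiff ℝ ∞ fun η : Rd d => dyadicSymbol χ j ((2 * Real.pi) • η) := by
    have := hχ.smooth
    by_cases h : j ≤ -1
    · simp only [dyadicSymbol, if_pos h]
      fun_prop
    · simp only [dyadicSymbol, if_neg h, annular]
      fun_prop
  exact h1.hasTemperateGrowth (Complex.ofRealCLM.contDiff.comp h2)

variable {χ : Rd d → ℝ} {j : ℤ} {f : 𝓢'(Rd d, ℂ)} {p : ℝ} {u : Rd d → ℝ}

theorem IsContinuousLpFunction.integrable_rpow {T : 𝓢'(Rd d, ℂ)} (hp : 2 ≤ p)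
    (hu : IsContinuousLpFunction T p u) : Integrable fun x => |u x| ^ p := by
  have := hu.memLp.integrable_norm_rpow (by simpa using by linarith) ENNReal.ofReal_ne_top
  simpa [ENNReal.toReal_ofReal (by linarith : 0 ≤ p)] using this

/-- A low-pass filter that is one on the spectrum of a dyadic block reproduces the block. In the
frequency variable `η = ξ / 2π` the block lives on `‖η‖ ≤ 3 / (4 π) * 2 ^ j < 2 ^ j ≤ s`. -/
theorem eq_integral_lowPass (hχ : IsRadialCutoff χ) (hj : -1 ≤ j) (hp : 2 ≤ p)
    (hu : IsContinuousLpFunction (dyadicBlock χ j f) p u) {A₀ A₁ A₂ s : ℝ} {B : 𝓢(Rd d, ℂ)}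
    {k : 𝓢(Rd d, ℝ)} (hk : IsLowPass A₀ A₁ A₂ s B k) (hs : (2 : ℝ) ^ j ≤ s) (x : Rd d) :
    u x = ∫ y, k y * u (x - y) := by
  have hup := hu.integrable_rpow hp
  have hm : (fun η : Rd d => ((dyadicSymbol χ j ((2 * Real.pi) • η) : ℝ) : ℂ)) * (B : Rd d → ℂ) =
      fun η : Rd d => ((dyadicSymbol χ j ((2 * Real.pi) • η) : ℝ) : ℂ) := by
    ext η
    rcases le_total ‖η‖ s with h | h
    · simp [hk.eq_one η h]
    · simp only [Pi.mul_apply]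
      rw [dyadicSymbol_eq_zero_of_le hχ hj]
      · simp
      · rw [norm_smul, Real.norm_of_nonneg (by positivity)]
        have : (0 : ℝ) < 2 ^ j := by positivity
        nlinarith [Real.pi_gt_three, norm_nonneg η]
  have hT : TemperedDistribution.fourierMultiplierCLM ℂ (B : Rd d → ℂ) (dyadicBlock χ j f) =
      dyadicBlock χ j f := by
    rw [dyadicBlock, TemperedDistribution.fourierMultiplierCLM_fourierMultiplierCLM_apply
      (hasTemperateGrowth_dyadicSymbol hχ hj) B.hasTemperateGrowth, hm]
  have heq := eq_of_integral_schwartz_mul_eq (a := fun x => (u x : ℂ))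
    (by have := hu.continuous; fun_prop) (continuous_schwartz_conv hp hu.continuous hup (𝓕⁻ B))
    fun g _ _ => by
      rw [← hu.apply_eq g, ← fourierMultiplier_apply_eq_integral hp hu.continuous hup hu.apply_eq,
        hT]
  have h2 := congrArg Complex.re (congrFun heq x)
  rw [Complex.ofReal_re, ← RCLike.re_eq_complex_re,
    ← integral_re (integrable_schwartz_mul hp hu.continuous hup _ x)] at h2
  rw [h2]
  refine integral_congr_ae (ae_of_all _ fun y => ?_)
  simp [hk.eq_re]

/-- A low-pass filter whose pass band avoids the spectrum of a dyadic block annihilates it. In the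
frequency variable `η = ξ / 2π` the filter lives on `‖η‖ < 2 * s` and the block on
`2 ^ j / (4 π) < ‖η‖`; the two are disjoint because `8 π < 32`. -/
theorem integral_lowPass_eq_zero (hχ : IsRadialCutoff χ) (hj : 0 ≤ j) (hp : 2 ≤ p)
    (hu : IsContinuousLpFunction (dyadicBlock χ j f) p u) {A₀ A₁ A₂ s : ℝ} {B : 𝓢(Rd d, ℂ)}
    {k : 𝓢(Rd d, ℝ)} (hk : IsLowPass A₀ A₁ A₂ s B k) (hs : 32 * s ≤ (2 : ℝ) ^ j) (x : Rd d) :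
    ∫ y, k y * u (x - y) = 0 := by
  have hup := hu.integrable_rpow hp
  have hm : (fun η : Rd d => ((dyadicSymbol χ j ((2 * Real.pi) • η) : ℝ) : ℂ)) * (B : Rd d → ℂ) =
      fun _ => 0 := by
    ext η
    rcases le_total ‖η‖ (2 * s) with h | h
    · simp only [Pi.mul_apply]
      rw [dyadicSymbol_eq_zero_of_ge hχ hj]
      · simp
      · rw [norm_smul, Real.norm_of_nonneg (by positivity)]
        have : (0 : ℝ) < 2 ^ j := by positivity
        nlinarith [Real.pi_lt_four, norm_nonneg η, Real.pi_pos]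
    · simp [hk.eq_zero η h]
  have hT : TemperedDistribution.fourierMultiplierCLM ℂ (B : Rd d → ℂ) (dyadicBlock χ j f) = 0 := by
    rw [dyadicBlock, TemperedDistribution.fourierMultiplierCLM_fourierMultiplierCLM_apply
      (hasTemperateGrowth_dyadicSymbol hχ (by omega)) B.hasTemperateGrowth, hm]
    simp
  have heq := eq_of_integral_schwartz_mul_eq (a := fun _ => (0 : ℂ)) continuous_const
    (continuous_schwartz_conv hp hu.continuous hup (𝓕⁻ B)) fun g _ _ => by
      rw [← fourierMultiplier_apply_eq_integral hp hu.continuous hup hu.apply_eq, hT]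
      simp
  have h2 := congrArg Complex.re (congrFun heq x)
  rw [Complex.zero_re, ← RCLike.re_eq_complex_re,
    ← integral_re (integrable_schwartz_mul hp hu.continuous hup _ x)] at h2
  rw [h2]
  refine integral_congr_ae (ae_of_all _ fun y => ?_)
  simp [hk.eq_re]

end Block

/-! ### The spectral measure of a square-integrable function -/

section Plancherel

variable {E : Type*} [NormedAddCommGroup E] [InnerProductSpace ℝ E] [FiniteDimensional ℝ E]
  [MeasurableSpace E] [BorelSpace E]

theorem lintegral_enorm_sq_eq (A : Lp (α := E) ℂ 2 volume) : ∫⁻ x, ‖A x‖ₑ ^ 2 = ‖A‖ₑ ^ 2 := by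
  have h := eLpNorm_nnreal_pow_eq_lintegral (μ := (volume : Measure E)) (f := A) (p := 2)
    two_ne_zero
  rw [Lp.enorm_def]
  have h2 : ((2 : NNReal) : ENNReal) = 2 := rfl
  rw [h2] at h
  have h3 : ((2 : NNReal) : ℝ) = ((2 : ℕ) : ℝ) := by norm_num
  simp only [h3, ENNReal.rpow_natCast] at h
  exact h.symm

theorem lintegral_enorm_fourier_sq (A : Lp (α := E) ℂ 2 volume) :
    ∫⁻ x, ‖(𝓕 A : Lp (α := E) ℂ 2 volume) x‖ₑ ^ 2 = ∫⁻ x, ‖A x‖ₑ ^ 2 := by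
  rw [lintegral_enorm_sq_eq, lintegral_enorm_sq_eq, ← ofReal_norm, ← ofReal_norm,
    Lp.norm_fourier_eq]

/-- Modulation of a Schwartz function, realised as the inverse Fourier transform of a translate. -/
theorem fourierInv_compSubConst_apply (g : 𝓢(E, ℂ)) (h η : E) :
    (𝓕⁻ (SchwartzMap.compSubConstCLM ℂ h (𝓕 g)) : 𝓢(E, ℂ)) η =
      Complex.exp (↑(2 * Real.pi * inner ℝ η h) * Complex.I) * g η := by
  have h0 : g η = (𝓕⁻ (𝓕 g) : 𝓢(E, ℂ)) η := by rw [fourierInv_fourier_eq]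
  rw [h0, SchwartzMap.fourierInv_coe, SchwartzMap.fourierInv_coe, Real.fourierInv_eq',
    Real.fourierInv_eq', ← integral_const_mul, ← integral_add_right_eq_self _ h]
  refine integral_congr_ae (ae_of_all _ fun x => ?_)
  simp only [SchwartzMap.compSubConstCLM_apply, add_sub_cancel_right, smul_eq_mul, ← mul_assoc,
    ← Complex.exp_add]
  congr 2
  rw [inner_add_left, real_inner_comm h η]
  push_cast
  ring

/-- Translation becomes modulation under the Fourier transform of `L²`. -/
theorem fourier_translate_ae_eq {f : E → ℂ} (h : E) (hf : MemLp f 2)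
    (hfh : MemLp (fun x => f (x + h)) 2) :
    (𝓕 (hfh.toLp _) : Lp (α := E) ℂ 2 volume) =ᵐ[volume] fun η =>
      Complex.exp (↑(2 * Real.pi * inner ℝ η h) * Complex.I) *
        (𝓕 (hf.toLp f) : Lp (α := E) ℂ 2 volume) η := by
  set F : Lp (α := E) ℂ 2 volume := 𝓕 (hf.toLp f) with hF
  have hW : MemLp (fun η => Complex.exp (↑(2 * Real.pi * inner ℝ η h) * Complex.I) * F η) 2 volume := by
    refine (Lp.memLp F).of_le (by fun_prop) (ae_of_all _ fun η => ?_)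
    rw [norm_mul, Complex.norm_exp_ofReal_mul_I, one_mul]
  have key : (𝓕 (hfh.toLp _) : Lp (α := E) ℂ 2 volume) = hW.toLp _ := by
    have hinj := LinearMap.ker_eq_bot.1
      (Lp.ker_toTemperedDistributionCLM_eq_bot (F := ℂ) (μ := (volume : Measure E)) (p := 2))
    refine hinj ?_
    change Lp.toTemperedDistribution _ = Lp.toTemperedDistribution _
    ext g
    set gh : 𝓢(E, ℂ) := 𝓕⁻ (SchwartzMap.compSubConstCLM ℂ h (𝓕 g)) with hgh
    have h1 : Lp.toTemperedDistribution (hW.toLp _ : Lp (α := E) ℂ 2 volume) g = Lp.toTemperedDistribution F gh := by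
      rw [Lp.toTemperedDistribution_apply, Lp.toTemperedDistribution_apply]
      refine integral_congr_ae ?_
      filter_upwards [hW.coeFn_toLp] with η hη
      rw [hη, hgh, fourierInv_compSubConst_apply]
      simp only [smul_eq_mul]
      ring
    rw [h1, hF, ← Lp.fourier_toTemperedDistribution_eq, ← Lp.fourier_toTemperedDistribution_eq,
      TemperedDistribution.fourier_apply, TemperedDistribution.fourier_apply, hgh,
      fourier_fourierInv_eq, Lp.toTemperedDistribution_apply, Lp.toTemperedDistribution_apply]
    have h2 : ∫ x, (𝓕 g : 𝓢(E, ℂ)) x • (hfh.toLp _ : Lp (α := E) ℂ 2 volume) x =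
        ∫ x, (𝓕 g : 𝓢(E, ℂ)) x • f (x + h) := by
      refine integral_congr_ae ?_
      filter_upwards [hfh.coeFn_toLp] with x hx
      rw [hx]
    have h3 : ∫ x, SchwartzMap.compSubConstCLM ℂ h (𝓕 g) x • (hf.toLp f : Lp (α := E) ℂ 2 volume) x =
        ∫ x, (𝓕 g : 𝓢(E, ℂ)) (x - h) • f x := by
      refine integral_congr_ae ?_
      filter_upwards [hf.coeFn_toLp] with x hx
      rw [hx, SchwartzMap.compSubConstCLM_apply]
    rw [h2, h3, ← integral_add_right_eq_self (fun x => (𝓕 g : 𝓢(E, ℂ)) (x - h) • f x) h]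
    simp
  rw [key]
  exact hW.coeFn_toLp

/-- Plancherel for translation differences: the squared `L²` norms of the differences
`v(· + h) - v` are the averages of `4 sin² (π ⟨η, h⟩)` over one finite measure, namely `|𝓕 v|² dη`. -/
theorem exists_spectral_measure {v : E → ℝ} (hv : Continuous v)
    (hv2 : Integrable fun x => v x ^ 2) :
    ∃ μ : Measure E, μ Set.univ = ENNReal.ofReal (∫ x, v x ^ 2) ∧
      ∀ h, ∫⁻ x, ENNReal.ofReal ((v (x + h) - v x) ^ 2) =
        ∫⁻ η, ENNReal.ofReal (4 * Real.sin (Real.pi * inner ℝ η h) ^ 2) ∂μ := by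
  set f : E → ℂ := fun x => (v x : ℂ) with hf
  have hmem : ∀ h : E, MemLp (fun x => f (x + h)) 2 volume := fun h => by
    rw [memLp_two_iff_integrable_sq_norm (by fun_prop)]
    simpa [hf] using hv2.comp_add_right h
  have hmem0 : MemLp f 2 volume := by simpa using hmem 0
  set F : Lp (α := E) ℂ 2 volume := 𝓕 (hmem0.toLp f) with hF
  have hsq : ∀ r : ℝ, ENNReal.ofReal (r ^ 2) = ‖(r : ℂ)‖ₑ ^ 2 := fun r => by
    rw [← ofReal_norm, Complex.norm_real, ← ENNReal.ofReal_pow (norm_nonneg _), Real.norm_eq_abs,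
      sq_abs]
  refine ⟨volume.withDensity fun η => ‖F η‖ₑ ^ 2, ?_, fun h => ?_⟩
  · rw [withDensity_apply _ MeasurableSet.univ, setLIntegral_univ, hF, lintegral_enorm_fourier_sq,
      ofReal_integral_eq_lintegral_ofReal hv2 (ae_of_all _ fun x => sq_nonneg _)]
    refine lintegral_congr_ae ?_
    filter_upwards [hmem0.coeFn_toLp] with x hx
    rw [hx, hsq]
  · have hpl := lintegral_enorm_fourier_sq ((hmem h).toLp _ - hmem0.toLp f)
    have h1 : ∫⁻ x, ENNReal.ofReal ((v (x + h) - v x) ^ 2) =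
        ∫⁻ x, ‖((hmem h).toLp _ - hmem0.toLp f : Lp (α := E) ℂ 2 volume) x‖ₑ ^ 2 := by
      refine lintegral_congr_ae ?_
      filter_upwards [hmem0.coeFn_toLp, (hmem h).coeFn_toLp,
        Lp.coeFn_sub ((hmem h).toLp _) (hmem0.toLp f)] with x hx hx' hx''
      rw [hx'', Pi.sub_apply, hx, hx', hsq]
      simp [hf]
    rw [h1, ← hpl, lintegral_withDensity_eq_lintegral_mul_non_measurable₀ _ (by fun_prop)
      (ae_of_all _ fun η => by finiteness)]
    have hsub : (𝓕 ((hmem h).toLp _ - hmem0.toLp f) : Lp (α := E) ℂ 2 volume) =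
        𝓕 ((hmem h).toLp _) - F := map_sub (Lp.fourierTransformₗᵢ E ℂ) _ _
    rw [hsub]
    refine lintegral_congr_ae ?_
    filter_upwards [fourier_translate_ae_eq h hmem0 (hmem h),
      Lp.coeFn_sub (𝓕 ((hmem h).toLp _) : Lp (α := E) ℂ 2 volume) F] with η hη hη'
    have h2 : Complex.exp (↑(2 * Real.pi * inner ℝ η h) * Complex.I) * F η - F η =
        (Complex.exp (↑(2 * Real.pi * inner ℝ η h) * Complex.I) - 1) * F η := by ring
    rw [hη', Pi.sub_apply, hη, ← hF, h2, enorm_mul, mul_pow, mul_comm, Pi.mul_apply]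
    congr 1
    have h3 := Complex.norm_exp_I_mul_ofReal_sub_one (2 * Real.pi * inner ℝ η h)
    rw [mul_comm Complex.I] at h3
    rw [← ofReal_norm, h3, ← ENNReal.ofReal_pow (norm_nonneg _), Real.norm_eq_abs, sq_abs]
    congr 1
    rw [show 2 * Real.pi * inner ℝ η h / 2 = Real.pi * inner ℝ η h by ring]
    ring

end Plancherel

/-! ### Regularity of band-limited functions -/

section Regularity

variable {E : Type*} [NormedAddCommGroup E] [InnerProductSpace ℝ E] [FiniteDimensional ℝ E]
  [MeasurableSpace E] [BorelSpace E] {p : ℝ} {u : E → ℝ}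

theorem integrable_rpow_sub_one_mul (hp : 2 ≤ p) (hu : Continuous u)
    (hup : Integrable fun x => |u x| ^ p) (a b : E) :
    Integrable fun x => signedPow (p - 1) (u (x + a)) * u (x + b) := by
  have hc := continuous_signedPow (q := p - 1) (by linarith)
  refine ((hup.comp_add_right a).add (hup.comp_add_right b)).mono' (by fun_prop)
    (ae_of_all _ fun x => ?_)
  rw [norm_mul, Real.norm_eq_abs, Real.norm_eq_abs, abs_signedPow (by linarith)]
  exact rpow_sub_one_mul_le hp (abs_nonneg _) (abs_nonneg _)

/-- A function reproduced by a Schwartz kernel is bounded and differentiable, with second-order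
Taylor remainders controlled by a function `W` that is itself controlled in `L^p`. -/
theorem exists_taylor_bound (hp : 2 ≤ p) (hu : Continuous u) (hup : Integrable fun x => |u x| ^ p)
    (k : 𝓢(E, ℝ)) (hrep : ∀ x, u x = ∫ y, k y * u (x - y)) {R : ℝ} (hR : 0 < R) :
    Differentiable ℝ u ∧ (∃ C, ∀ x, |u x| ≤ C) ∧
    ∃ W : E → ℝ, (∀ x, 0 ≤ W x) ∧ Integrable (fun x => |u x| ^ (p - 1) * W x) ∧
      ∀ x h, ‖h‖ ≤ R → |u (x + h) - u x - fderiv ℝ u x h| ≤ ‖h‖ ^ 2 * W x := by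
  obtain ⟨w, hw, hw0, ⟨B, hB⟩, hwi, hDk, hk, -, hT⟩ := k.exists_weight hR.le
  have hwu := integrable_weight_mul hp hu hup hw hw0 hB hwi
  have hkc : Continuous (fderiv ℝ k) := (k.smooth 1).continuous_fderiv (by norm_num)
  have hki : ∀ h, ‖h‖ ≤ R → ∀ x, Integrable fun y => k (y + h) * u (x - y) := fun h hh x => by
    refine (hwu x).1.mono' (by fun_prop) (ae_of_all _ fun y => ?_)
    rw [norm_mul, Real.norm_eq_abs (u _)]
    gcongr
    exact hk y h hh
  have hki0 : ∀ x, Integrable fun y => k y * u (x - y) := fun x => by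
    simpa using hki 0 (by simpa using hR.le) x
  have hLi : ∀ x, Integrable fun y => u (x - y) • fderiv ℝ k y := fun x => by
    refine (hwu x).1.mono' (by fun_prop) (ae_of_all _ fun y => ?_)
    rw [norm_smul, mul_comm, Real.norm_eq_abs]
    gcongr
    exact hDk y
  set L : E → E →L[ℝ] ℝ := fun x => ∫ y, u (x - y) • fderiv ℝ k y with hL
  have hrem : ∀ x h, ‖h‖ ≤ R → |u (x + h) - u x - L x h| ≤ ‖h‖ ^ 2 * ∫ y, w y * |u (x - y)| := by
    intro x h hh
    have h1 : u (x + h) = ∫ y, k (y + h) * u (x - y) := by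
      rw [hrep, ← integral_add_right_eq_self _ h]
      simp
    have h2 : L x h = ∫ y, u (x - y) * fderiv ℝ k y h := by
      rw [hL]
      simp only
      rw [ContinuousLinearMap.integral_apply (hLi x)]
      rfl
    have hLi' : Integrable fun y => u (x - y) * fderiv ℝ k y h :=
      (hLi x).apply_continuousLinearMap h
    rw [h1, hrep x, h2, ← integral_sub (hki h hh x) (hki0 x),
      ← integral_sub (f := fun y => k (y + h) * u (x - y) - k y * u (x - y))
        ((hki h hh x).sub (hki0 x)) hLi', ← integral_const_mul]
    refine (abs_integral_le_integral_abs).trans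
      (integral_mono (((hki h hh x).sub (hki0 x)).sub hLi').abs ((hwu x).1.const_mul _) fun y => ?_)
    have := hT y h hh
    calc |k (y + h) * u (x - y) - k y * u (x - y) - u (x - y) * fderiv ℝ k y h|
        = ‖k (y + h) - k y - fderiv ℝ k y h‖ * |u (x - y)| := by
          rw [Real.norm_eq_abs, ← abs_mul]; ring_nf
      _ ≤ ‖h‖ ^ 2 * w y * |u (x - y)| := by gcongr
      _ = _ := by ring
  have hder : ∀ x, HasFDerivAt u (L x) x := fun x => by
    rw [hasFDerivAt_iff_isLittleO_nhds_zero]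
    refine Asymptotics.IsBigO.trans_isLittleO (g := fun h : E => ‖h‖ ^ 2) ?_
      (Asymptotics.isLittleO_norm_pow_id one_lt_two)
    refine Asymptotics.IsBigO.of_bound (∫ y, w y * |u (x - y)|) ?_
    filter_upwards [Metric.closedBall_mem_nhds (0 : E) hR] with h hh
    rw [norm_pow, norm_norm, mul_comm]
    exact hrem x h (by simpa using hh)
  refine ⟨fun x => (hder x).differentiableAt, ⟨(∫ y, w y) + B * ∫ y, |u y| ^ p, fun x => ?_⟩,
    fun x => ∫ y, w y * |u (x - y)|, fun x => integral_nonneg fun y => by positivity [hw0 y], ?_,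
    fun x h hh => ?_⟩
  · rw [hrep x]
    refine (abs_integral_le_integral_abs.trans
      (integral_mono (hki0 x).abs (hwu x).1 fun y => ?_)).trans (hwu x).2
    simp only [abs_mul]
    gcongr
    simpa using hk y 0 (by simpa using hR.le)
  · have hconv : Integrable fun x => ∫ y, w y * |u (x - y)| ^ p := by
      exact hwi.integrable_convolution (ContinuousLinearMap.mul ℝ ℝ) hup
    have hmeas : StronglyMeasurable fun x => ∫ y, w y * |u (x - y)| :=
      StronglyMeasurable.integral_prod_right (f := fun x y => w y * |u (x - y)|)
        (by fun_prop : Continuous _).stronglyMeasurable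
    have hmeas' : AEStronglyMeasurable (fun x => |u x| ^ (p - 1)) (volume : Measure E) :=
      (hu.abs.rpow_const fun _ => Or.inr (by linarith)).aestronglyMeasurable
    refine ((hup.const_mul (∫ y, w y)).add hconv).mono' (hmeas'.mul hmeas.aestronglyMeasurable) ?_
    have hci : ∀ᵐ x ∂(volume : Measure E), Integrable fun y => w y * |u (x - y)| ^ p := by
      have := hwi.convolution_integrand (ContinuousLinearMap.mul ℝ ℝ) hup
      simpa using this.prod_right_ae
    filter_upwards [hci] with x hx
    rw [Real.norm_of_nonneg (mul_nonneg (by positivity)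
      (integral_nonneg fun y => mul_nonneg (hw0 y) (abs_nonneg _))), ← integral_const_mul,
      Pi.add_apply, ← integral_mul_const, ← integral_add (hwi.mul_const _) hx]
    refine integral_mono ((hwu x).1.const_mul _) ((hwi.mul_const _).add hx) fun y => ?_
    have := mul_le_mul_of_nonneg_left
      (rpow_sub_one_mul_le hp (abs_nonneg (u x)) (abs_nonneg (u (x - y)))) (hw0 y)
    simp only
    linarith
  · rw [(hder x).fderiv]
    exact hrem x h hh

end Regularity

/-! ### The energy identity -/

section Energy

variable {d : ℕ} {ν : Measure (Rd d)} {σ : Rd d →L[ℝ] Rd d} {p : ℝ} {u : Rd d → ℝ}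

theorem IsLevyMeasure.integrable_min (hν : IsLevyMeasure ν) :
    Integrable (fun z : Rd d => min 1 (‖z‖ ^ 2)) ν := by
  refine ⟨by fun_prop, ?_⟩
  rw [hasFiniteIntegral_iff_ofReal (ae_of_all _ fun z => by positivity)]
  exact hν.lintegral_lt_top

/-- A Lévy measure has a positive density with respect to the finite measure `min(1, |z|²) ν(dz)`. -/
theorem IsLevyMeasure.sigmaFinite (hν : IsLevyMeasure ν) : SigmaFinite ν := by
  set m : Rd d → ENNReal := fun z => ENNReal.ofReal (min 1 (‖z‖ ^ 2)) with hm
  have hm' : Measurable m := by fun_prop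
  have : IsFiniteMeasure (ν.withDensity m) := isFiniteMeasure_withDensity hν.lintegral_lt_top.ne
  have hne : ∀ᵐ z ∂ν, m z ≠ 0 := by
    have h0 : ∀ᵐ z ∂ν, z ≠ 0 := by
      rw [ae_iff]
      simpa using hν.zero
    filter_upwards [h0] with z hz
    have : 0 < min 1 (‖z‖ ^ 2) := lt_min one_pos (by positivity)
    exact (ENNReal.ofReal_pos.2 this).ne'
  rw [← withDensity_inv_same hm' hne (ae_of_all _ fun z => ENNReal.ofReal_ne_top)]
  refine SigmaFinite.withDensity_of_ne_top ?_
  rw [ae_withDensity_iff hm']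
  exact ae_of_all _ fun z hz => ENNReal.inv_ne_top.2 hz

/-- The `p`-form of the increment `u(· + h) - u`. -/
noncomputable def differenceEnergy (p : ℝ) (u : Rd d → ℝ) (h : Rd d) : ℝ :=
  ∫ x, (signedPow (p - 1) (u (x + h)) - signedPow (p - 1) (u x)) * (u (x + h) - u x)

theorem integrable_differenceEnergy (hp : 2 ≤ p) (hu : Continuous u)
    (hup : Integrable fun x => |u x| ^ p) (h : Rd d) :
    Integrable fun x =>
      (signedPow (p - 1) (u (x + h)) - signedPow (p - 1) (u x)) * (u (x + h) - u x) := by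
  have hi := integrable_rpow_sub_one_mul hp hu hup
  refine (((hi h h).sub (hi h 0)).sub ((hi 0 h).sub (hi 0 0))).congr (ae_of_all _ fun x => ?_)
  simp only [Pi.sub_apply, add_zero]
  ring

theorem differenceEnergy_nonneg (hp : 2 ≤ p) (h : Rd d) : 0 ≤ differenceEnergy p u h :=
  integral_nonneg fun _ => signedPow_sub_mul_nonneg hp _ _

/-- Summation by parts: translation invariance moves the second difference onto the nonlinearity. -/
theorem integral_signedPow_mul_second_difference (hp : 2 ≤ p) (hu : Continuous u)
    (hup : Integrable fun x => |u x| ^ p) (h : Rd d) :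
    ∫ x, signedPow (p - 1) (u x) * (u (x + h) + u (x - h) - 2 * u x) = -differenceEnergy p u h := by
  have hi := integrable_rpow_sub_one_mul hp hu hup
  have hshift : ∀ a b c : Rd d, ∫ x, signedPow (p - 1) (u (x + a)) * u (x + b) =
      ∫ x, signedPow (p - 1) (u (x + (a + c))) * u (x + (b + c)) := fun a b c => by
    rw [← integral_add_right_eq_self (fun x => signedPow (p - 1) (u (x + a)) * u (x + b)) c]
    simp only [add_assoc, add_comm c]
  have h1 : differenceEnergy p u h =
      ((∫ x, signedPow (p - 1) (u (x + h)) * u (x + h)) -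
        ∫ x, signedPow (p - 1) (u (x + h)) * u (x + 0)) -
      ((∫ x, signedPow (p - 1) (u (x + 0)) * u (x + h)) -
        ∫ x, signedPow (p - 1) (u (x + 0)) * u (x + 0)) := by
    rw [← integral_sub' (hi h h) (hi h 0), ← integral_sub' (hi 0 h) (hi 0 0),
      ← integral_sub' ((hi h h).sub (hi h 0)) ((hi 0 h).sub (hi 0 0))]
    refine integral_congr_ae (ae_of_all _ fun x => ?_)
    simp only [Pi.sub_apply, add_zero]
    ring
  have h2 : ∫ x, signedPow (p - 1) (u x) * (u (x + h) + u (x - h) - 2 * u x) =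
      (∫ x, signedPow (p - 1) (u (x + 0)) * u (x + h)) +
        (∫ x, signedPow (p - 1) (u (x + 0)) * u (x + -h)) -
      2 * ∫ x, signedPow (p - 1) (u (x + 0)) * u (x + 0) := by
    rw [← integral_add' (hi 0 h) (hi 0 (-h)), ← integral_const_mul,
      ← integral_sub' ((hi 0 h).add (hi 0 (-h))) ((hi 0 0).const_mul 2)]
    refine integral_congr_ae (ae_of_all _ fun x => ?_)
    simp only [Pi.add_apply, Pi.sub_apply, add_zero, ← sub_eq_add_neg]
    ring
  have h3 := hshift h h (-h)
  have h4 := hshift h 0 (-h)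
  rw [add_neg_cancel] at h3 h4
  rw [zero_add] at h4
  rw [h1, h2, h3, h4]
  ring

theorem levyIntegrand_add_neg (x z : Rd d) :
    levyIntegrand σ u x z + levyIntegrand σ u x (-z) = u (x + σ z) + u (x - σ z) - 2 * u x := by
  have h : (Metric.ball (0 : Rd d) 1).indicator (fun z => fderiv ℝ u x (σ z)) (-z) =
      -(Metric.ball (0 : Rd d) 1).indicator (fun z => fderiv ℝ u x (σ z)) z := by
    by_cases hz : z ∈ Metric.ball (0 : Rd d) 1
    · have hz' : -z ∈ Metric.ball (0 : Rd d) 1 := by simpa using hz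
      simp [Set.indicator_of_mem hz, Set.indicator_of_mem hz']
    · have hz' : -z ∉ Metric.ball (0 : Rd d) 1 := by simpa using hz
      simp [Set.indicator_of_notMem hz, Set.indicator_of_notMem hz']
  simp only [levyIntegrand]
  rw [h, map_neg, ← sub_eq_add_neg]
  ring

theorem measurable_levyIntegrand (hu : Continuous u) :
    Measurable fun q : Rd d × Rd d => levyIntegrand σ u q.1 q.2 := by
  have h1 : Measurable fun q : Rd d × Rd d => fderiv ℝ u q.1 (σ q.2) :=
    (isBoundedBilinearMap_apply (𝕜 := ℝ) (E := Rd d) (F := ℝ)).continuous.measurable.comp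
      (((measurable_fderiv ℝ u).comp measurable_fst).prodMk (σ.measurable.comp measurable_snd))
  have h2 : Measurable fun q : Rd d × Rd d =>
      (Metric.ball (0 : Rd d) 1).indicator (fun z => fderiv ℝ u q.1 (σ z)) q.2 :=
    Measurable.indicator h1 (measurable_snd Metric.isOpen_ball.measurableSet)
  have h3 : Measurable fun q : Rd d × Rd d => u (q.1 + σ q.2) - u q.1 := by
    have : Continuous fun q : Rd d × Rd d => u (q.1 + σ q.2) - u q.1 := by fun_prop
    exact this.measurable
  exact h3.sub h2

/-- The nonlocal energy of a band-limited function is well defined, and symmetry of `ν` turns it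
into an average of the nonnegative difference energies. -/
theorem energy_identity (hp : 2 ≤ p) (hu : Continuous u) (hup : Integrable fun x => |u x| ^ p)
    (k : 𝓢(Rd d, ℝ)) (hrep : ∀ x, u x = ∫ y, k y * u (x - y)) (hν : IsLevyMeasure ν)
    (hsym : IsSymmetricMeasure ν) {Λ : ℝ} (hΛ : 1 ≤ Λ) (hσ : ∀ z, ‖σ z‖ ≤ Λ * ‖z‖) :
    Differentiable ℝ u ∧ (∀ x, Integrable (levyIntegrand σ u x) ν) ∧
      Integrable (energyDensity ν σ p u) ∧ Integrable (fun z => differenceEnergy p u (σ z)) ν ∧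
      2 * ∫ x, energyDensity ν σ p u x = -∫ z, differenceEnergy p u (σ z) ∂ν := by
  have := hν.sigmaFinite
  obtain ⟨hdiff, ⟨C, hC⟩, W, hW0, hWi, hW⟩ :=
    exists_taylor_bound hp hu hup k hrep (R := Λ) (by linarith)
  set m : Rd d → ℝ := fun z => min 1 (‖z‖ ^ 2) with hm
  have hm0 : ∀ z, 0 ≤ m z := fun z => by positivity
  have hmi : Integrable m ν := hν.integrable_min
  have hmeas := measurable_levyIntegrand (σ := σ) hu
  -- Taylor's formula for the small jumps, the triangle inequality for the large ones
  have hbound : ∀ x z, |levyIntegrand σ u x z| ≤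
      m z * (Λ ^ 2 * W x + |u x| + |u (x + σ z)|) := by
    intro x z
    have hWx : 0 ≤ Λ ^ 2 * W x := mul_nonneg (sq_nonneg _) (hW0 x)
    simp only [levyIntegrand]
    by_cases hz : z ∈ Metric.ball (0 : Rd d) 1
    · rw [Set.indicator_of_mem hz]
      have hz1 : ‖z‖ < 1 := by simpa using hz
      have hmz : m z = ‖z‖ ^ 2 := min_eq_right (by nlinarith [norm_nonneg z])
      have hσz : ‖σ z‖ ≤ Λ := (hσ z).trans (by nlinarith [norm_nonneg z])
      calc |u (x + σ z) - u x - fderiv ℝ u x (σ z)| ≤ ‖σ z‖ ^ 2 * W x := hW x _ hσz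
        _ ≤ (Λ * ‖z‖) ^ 2 * W x := by gcongr; exacts [hW0 x, hσ z]
        _ = ‖z‖ ^ 2 * (Λ ^ 2 * W x) := by ring
        _ ≤ _ := by
          rw [hmz]
          gcongr
          linarith [abs_nonneg (u x), abs_nonneg (u (x + σ z))]
    · rw [Set.indicator_of_notMem hz, sub_zero]
      have hz1 : 1 ≤ ‖z‖ := by simpa using hz
      have hmz : m z = 1 := min_eq_left (by nlinarith)
      rw [hmz, one_mul]
      linarith [abs_sub (u (x + σ z)) (u x)]
  have hlevy : ∀ x, Integrable (levyIntegrand σ u x) ν := fun x => by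
    refine (hmi.mul_const (Λ ^ 2 * W x + C + C)).mono'
      (hmeas.comp measurable_prodMk_left).aestronglyMeasurable (ae_of_all _ fun z => ?_)
    refine (hbound x z).trans (mul_le_mul_of_nonneg_left ?_ (hm0 z))
    linarith [hC x, hC (x + σ z)]
  set F : Rd d × Rd d → ℝ := fun q => signedPow (p - 1) (u q.1) * levyIntegrand σ u q.1 q.2 with hF
  have hcs := continuous_signedPow (q := p - 1) (by linarith)
  have hFi : Integrable F (volume.prod ν) := by
    have hM1 : Integrable (fun q : Rd d × Rd d => (|u q.1| ^ (p - 1) * W q.1) * m q.2)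
        (volume.prod ν) := hWi.mul_prod hmi
    have hM2 : Integrable (fun q : Rd d × Rd d => |u q.1| ^ p * m q.2) (volume.prod ν) :=
      hup.mul_prod hmi
    have hM3 : Integrable (fun q : Rd d × Rd d => |u (q.1 + σ q.2)| ^ p * m q.2)
        (volume.prod ν) := by
      rw [integrable_prod_iff']
      · refine ⟨ae_of_all _ fun z => (hup.comp_add_right (σ z)).mul_const (m z), ?_⟩
        have : ∀ z, ∫ x, ‖|u (x + σ z)| ^ p * m z‖ = (∫ x, |u x| ^ p) * m z := fun z => by
          simp_rw [Real.norm_of_nonneg (mul_nonneg (Real.rpow_nonneg (abs_nonneg _) p) (hm0 z))]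
          rw [integral_mul_const, integral_add_right_eq_self (fun x => |u x| ^ p)]
        simp_rw [this]
        exact hmi.const_mul _
      · have : Continuous fun q : Rd d × Rd d => |u (q.1 + σ q.2)| ^ p * m q.2 :=
          ((hu.comp (by fun_prop)).abs.rpow_const fun _ => Or.inr (by linarith)).mul (by fun_prop)
        exact this.aestronglyMeasurable
    refine (((hM1.const_mul (Λ ^ 2)).add (hM2.const_mul 3)).add hM3).mono'
      (((hcs.comp hu).measurable.comp measurable_fst).mul hmeas).aestronglyMeasurable
      (ae_of_all _ fun q => ?_)
    have h1 := rpow_sub_one_mul_le hp (abs_nonneg (u q.1)) (abs_nonneg (u q.1))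
    have h2 := rpow_sub_one_mul_le hp (abs_nonneg (u q.1)) (abs_nonneg (u (q.1 + σ q.2)))
    have h0 : 0 ≤ |u q.1| ^ (p - 1) := by positivity
    rw [hF]
    simp only [norm_mul, Real.norm_eq_abs, Pi.add_apply]
    rw [abs_signedPow (by linarith)]
    calc |u q.1| ^ (p - 1) * |levyIntegrand σ u q.1 q.2|
        ≤ |u q.1| ^ (p - 1) * (m q.2 * (Λ ^ 2 * W q.1 + |u q.1| + |u (q.1 + σ q.2)|)) := by
          gcongr; exact hbound _ _
      _ = Λ ^ 2 * (|u q.1| ^ (p - 1) * W q.1 * m q.2) +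
          (|u q.1| ^ (p - 1) * |u q.1| + |u q.1| ^ (p - 1) * |u (q.1 + σ q.2)|) * m q.2 := by ring
      _ ≤ Λ ^ 2 * (|u q.1| ^ (p - 1) * W q.1 * m q.2) +
          ((|u q.1| ^ p + |u q.1| ^ p) + (|u q.1| ^ p + |u (q.1 + σ q.2)| ^ p)) * m q.2 := by
          gcongr
      _ = _ := by ring
  have hdens : energyDensity ν σ p u = fun x => ∫ z, F (x, z) ∂ν := by
    ext x
    simp only [energyDensity, levyOp, hF, signedPow, integral_const_mul]
    rw [show p - 1 - 1 = p - 2 by ring]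
  set J : Rd d → ℝ := fun z => ∫ x, F (x, z) with hJ
  have hJi : Integrable J ν := hFi.integral_prod_right
  have hneg : MeasurePreserving (fun z : Rd d => -z) ν ν := ⟨measurable_neg, hsym⟩
  have hsec : ∀ᵐ z ∂ν, Integrable fun x => F (x, z) := hFi.prod_left_ae
  have hJE : ∀ᵐ z ∂ν, J z + J (-z) = -differenceEnergy p u (σ z) := by
    filter_upwards [hsec, hneg.quasiMeasurePreserving.ae hsec] with z h1 h2
    rw [hJ]
    simp only
    rw [← integral_add h1 h2, ← integral_signedPow_mul_second_difference hp hu hup]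
    refine integral_congr_ae (ae_of_all _ fun x => ?_)
    simp only [hF]
    rw [← mul_add, levyIntegrand_add_neg]
  have hJneg : Integrable (fun z => J (-z)) ν := hneg.integrable_comp_of_integrable hJi
  refine ⟨hdiff, hlevy, hdens ▸ hFi.integral_prod_left, ?_, ?_⟩
  · refine ((hJi.add hJneg).neg).congr ?_
    filter_upwards [hJE] with z hz
    rw [Pi.neg_apply, Pi.add_apply, hz, neg_neg]
  · rw [hdens, integral_integral_swap (f := fun x z => F (x, z)) hFi, ← integral_neg,
      ← integral_congr_ae hJE, integral_add hJi hJneg,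
      hneg.integral_comp (MeasurableEquiv.neg (Rd d)).measurableEmbedding J]
    ring

end Energy

/-! ### Spectral localisation of the half power -/

section Jensen

theorem rpow_lintegral_le {α : Type*} [MeasurableSpace α] (κ : Measure α) {p : ℝ} (hp : 1 < p)
    {F : α → ENNReal} (hF : AEMeasurable F κ) :
    (∫⁻ y, F y ∂κ) ^ p ≤ κ Set.univ ^ (p - 1) * ∫⁻ y, F y ^ p ∂κ := by
  have hp0 : 0 < p := by linarith
  have hpq := Real.HolderConjugate.conjExponent hp
  have h := ENNReal.lintegral_mul_le_Lp_mul_Lq κ hpq hF (aemeasurable_const (b := (1 : ENNReal)))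
  simp only [Pi.mul_apply, mul_one, ENNReal.one_rpow, lintegral_const, one_mul] at h
  refine (ENNReal.rpow_le_rpow h hp0.le).trans_eq ?_
  rw [ENNReal.mul_rpow_of_nonneg _ _ hp0.le, ← ENNReal.rpow_mul, ← ENNReal.rpow_mul,
    one_div_mul_cancel hp0.ne', ENNReal.rpow_one, mul_comm]
  congr 2
  rw [Real.conjExponent]
  field_simp

variable {E : Type*} [NormedAddCommGroup E] [InnerProductSpace ℝ E] [FiniteDimensional ℝ E]
  [MeasurableSpace E] [BorelSpace E]

/-- Jensen's inequality for a signed kernel. -/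
theorem enorm_integral_mul_rpow_le {p : ℝ} (hp : 1 < p) {g D : E → ℝ} (hg : Continuous g)
    (hD : Continuous D) :
    ‖∫ y, g y * D y‖ₑ ^ p ≤ (∫⁻ y, ‖g y‖ₑ) ^ (p - 1) * ∫⁻ y, ‖g y‖ₑ * ‖D y‖ₑ ^ p := by
  have hgm : Measurable fun y => ‖g y‖ₑ := by fun_prop
  have hDm : Measurable fun y => ‖D y‖ₑ := by fun_prop
  have h := rpow_lintegral_le (volume.withDensity fun y => ‖g y‖ₑ) hp hDm.aemeasurable
  rw [lintegral_withDensity_eq_lintegral_mul _ hgm hDm,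
    lintegral_withDensity_eq_lintegral_mul _ hgm (hDm.pow_const p),
    withDensity_apply _ MeasurableSet.univ, setLIntegral_univ] at h
  refine (ENNReal.rpow_le_rpow ?_ (by linarith)).trans h
  refine (enorm_integral_le_lintegral_enorm _).trans_eq ?_
  simp [enorm_mul]

/-- Averaging translation differences against a kernel, in `L^p`. -/
theorem lintegral_enorm_integral_mul_rpow_le {p : ℝ} (hp : 1 < p) {g : E → ℝ} {D : E → E → ℝ}
    (hg : Continuous g) (hD : Continuous fun q : E × E => D q.1 q.2) :
    ∫⁻ x, ‖∫ y, g y * D x y‖ₑ ^ p ≤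
      (∫⁻ y, ‖g y‖ₑ) ^ (p - 1) * ∫⁻ y, ‖g y‖ₑ * ∫⁻ x, ‖D x y‖ₑ ^ p := by
  have hDm : Measurable fun q : E × E => ‖D q.1 q.2‖ₑ ^ p := hD.enorm.measurable.pow_const p
  have hm : Measurable fun q : E × E => ‖g q.2‖ₑ * ‖D q.1 q.2‖ₑ ^ p :=
    (hg.comp continuous_snd).enorm.measurable.mul hDm
  calc ∫⁻ x, ‖∫ y, g y * D x y‖ₑ ^ p
      ≤ ∫⁻ x, (∫⁻ y, ‖g y‖ₑ) ^ (p - 1) * ∫⁻ y, ‖g y‖ₑ * ‖D x y‖ₑ ^ p :=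
        lintegral_mono fun x => enorm_integral_mul_rpow_le hp hg
          (hD.comp (Continuous.prodMk_right x))
    _ = (∫⁻ y, ‖g y‖ₑ) ^ (p - 1) * ∫⁻ y, ∫⁻ x, ‖g y‖ₑ * ‖D x y‖ₑ ^ p := by
        rw [lintegral_const_mul _ hm.lintegral_prod_right', lintegral_lintegral_swap hm.aemeasurable]
    _ = _ := by
        congr 1
        refine lintegral_congr fun y => ?_
        rw [lintegral_const_mul]
        exact hDm.comp measurable_prodMk_right

end Jensen

section Spectral

variable {E : Type*} [NormedAddCommGroup E] [InnerProductSpace ℝ E] [FiniteDimensional ℝ E]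
  [MeasurableSpace E] [BorelSpace E] {p : ℝ} {u : E → ℝ}

/-- The squared `L²` norm of the increment of the half power of `u`. -/
noncomputable def halfPowerDifference (p : ℝ) (u : E → ℝ) (h : E) : ENNReal :=
  ∫⁻ x, ENNReal.ofReal ((signedPow (p / 2) (u (x + h)) - signedPow (p / 2) (u x)) ^ 2)

theorem lintegral_enorm_rpow (hp : 2 ≤ p) (hup : Integrable fun x => |u x| ^ p) :
    ∫⁻ x, ‖u x‖ₑ ^ p = ENNReal.ofReal (∫ x, |u x| ^ p) := by
  rw [ofReal_integral_eq_lintegral_ofReal hup (ae_of_all _ fun x => by positivity)]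
  refine lintegral_congr fun x => ?_
  rw [← ofReal_norm, ENNReal.ofReal_rpow_of_nonneg (norm_nonneg _) (by linarith),
    Real.norm_eq_abs]

theorem lintegral_enorm_le_ofReal {g : E → ℝ} {A : ℝ} (hg : Integrable g) (hA : ∫ y, |g y| ≤ A) :
    ∫⁻ y, ‖g y‖ₑ ≤ ENNReal.ofReal A := by
  rw [← ofReal_integral_norm_eq_lintegral_enorm hg]
  exact ENNReal.ofReal_le_ofReal hA

/-- Bernstein's inequality for the half power, in terms of differences. -/
theorem halfPowerDifference_le (hp : 2 ≤ p) (hu : Continuous u)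
    (hup : Integrable fun x => |u x| ^ p) {A₀ A₁ A₂ s : ℝ} (hA₁ : 0 ≤ A₁) (hs : 0 < s)
    {B : 𝓢(E, ℂ)} {k : 𝓢(E, ℝ)} (hk : IsLowPass A₀ A₁ A₂ s B k)
    (hrep : ∀ x, u x = ∫ y, k y * u (x - y)) (h : E) :
    halfPowerDifference p u h ≤
      ENNReal.ofReal (3 * (p / 2 + 2) ^ 2 * (A₁ + 1) ^ 2 * s ^ 2 * ‖h‖ ^ 2) *
        ENNReal.ofReal (∫ x, |u x| ^ p) := by
  rcases eq_or_ne h 0 with rfl | hh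
  · simp [halfPowerDifference]
  set M := ENNReal.ofReal (∫ x, |u x| ^ p) with hM
  -- `t` bounds the ratio of the `L^p` norms of the increment and of `u`; it serves as the weight in
  -- the pointwise inequality, which makes the three resulting terms equally large
  set t := (A₁ + 1) * (s * ‖h‖) with ht
  have ht0 : 0 < t := by positivity
  have hp0 : (0 : ℝ) ≤ p := by linarith
  have hki := k.integrable (μ := (volume : Measure E))
  set g : E → ℝ := fun y => k (y + h) - k y with hg
  have hgc : Continuous g := by fun_prop
  have hga : ∫⁻ y, ‖g y‖ₑ ≤ ENNReal.ofReal t :=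
    lintegral_enorm_le_ofReal ((hki.comp_add_right h).sub hki)
      ((hk.smoothness h).trans (by rw [ht]; gcongr; linarith))
  have hkui : ∀ a x, Integrable fun y => k (y + a) * u (x - y) := fun a x => by
    obtain ⟨w, hw, hw0, ⟨B, hB⟩, hwi, -, hkw, -, -⟩ := k.exists_weight (norm_nonneg a)
    refine (integrable_weight_mul hp hu hup hw hw0 hB hwi x).1.mono' (by fun_prop)
      (ae_of_all _ fun y => ?_)
    rw [norm_mul, Real.norm_eq_abs (u _)]
    gcongr
    exact hkw y a le_rfl
  have hdiff : ∀ x, u (x + h) - u x = ∫ y, g y * u (x - y) := fun x => by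
    have h1 : u (x + h) = ∫ y, k (y + h) * u (x - y) := by
      rw [hrep, ← integral_add_right_eq_self _ h]
      simp
    have h0 := hkui 0 x
    simp only [add_zero] at h0
    rw [h1, hrep x, ← integral_sub (hkui h x) h0]
    refine integral_congr_ae (ae_of_all _ fun y => ?_)
    simp only [hg]
    ring
  have hLp : ∫⁻ x, ‖u (x + h) - u x‖ₑ ^ p ≤ ENNReal.ofReal t ^ p * M := by
    simp_rw [hdiff]
    refine (lintegral_enorm_integral_mul_rpow_le (by linarith) hgc (by fun_prop)).trans ?_
    have hx : ∀ y, ∫⁻ x, ‖u (x - y)‖ₑ ^ p = M := fun y => by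
      rw [lintegral_sub_right_eq_self (fun x => ‖u x‖ₑ ^ p) y, lintegral_enorm_rpow hp hup]
    simp_rw [hx]
    rw [lintegral_mul_const _ (by fun_prop), ← mul_assoc]
    gcongr
    calc (∫⁻ y, ‖g y‖ₑ) ^ (p - 1) * ∫⁻ y, ‖g y‖ₑ
        ≤ ENNReal.ofReal t ^ (p - 1) * ENNReal.ofReal t := by gcongr; linarith
      _ = ENNReal.ofReal t ^ p := by
        nth_rw 2 [← ENNReal.rpow_one (ENNReal.ofReal t)]
        rw [← ENNReal.rpow_add _ _ (ENNReal.ofReal_pos.2 ht0).ne' ENNReal.ofReal_ne_top,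
          sub_add_cancel]
  have hpt : ∀ x, ENNReal.ofReal ((signedPow (p / 2) (u (x + h)) - signedPow (p / 2) (u x)) ^ 2) ≤
      ENNReal.ofReal ((p / 2 + 2) ^ 2 * t ^ 2) * (‖u (x + h)‖ₑ ^ p + ‖u x‖ₑ ^ p +
        ENNReal.ofReal t⁻¹ ^ p * ‖u (x + h) - u x‖ₑ ^ p) := fun x => by
    have h1 := sq_signedPow_sub_le_weighted hp ht0 (u (x + h)) (u x)
    refine (ENNReal.ofReal_le_ofReal h1).trans_eq ?_
    simp only [← ofReal_norm, Real.norm_eq_abs]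
    rw [← ENNReal.mul_rpow_of_nonneg _ _ hp0, ← ENNReal.ofReal_mul (by positivity),
      ENNReal.ofReal_rpow_of_nonneg (abs_nonneg _) hp0,
      ENNReal.ofReal_rpow_of_nonneg (abs_nonneg _) hp0,
      ENNReal.ofReal_rpow_of_nonneg (by positivity) hp0, ENNReal.ofReal_mul (by positivity),
      ENNReal.ofReal_add (by positivity) (by positivity),
      ENNReal.ofReal_add (by positivity) (by positivity)]
  have hcancel : ENNReal.ofReal t⁻¹ ^ p * ENNReal.ofReal t ^ p = 1 := by
    rw [← ENNReal.mul_rpow_of_nonneg _ _ hp0, ← ENNReal.ofReal_mul (by positivity),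
      inv_mul_cancel₀ ht0.ne', ENNReal.ofReal_one, ENNReal.one_rpow]
  calc halfPowerDifference p u h ≤ ∫⁻ x, ENNReal.ofReal ((p / 2 + 2) ^ 2 * t ^ 2) *
        (‖u (x + h)‖ₑ ^ p + ‖u x‖ₑ ^ p +
          ENNReal.ofReal t⁻¹ ^ p * ‖u (x + h) - u x‖ₑ ^ p) := lintegral_mono hpt
    _ = ENNReal.ofReal ((p / 2 + 2) ^ 2 * t ^ 2) * (M + M +
          ENNReal.ofReal t⁻¹ ^ p * ∫⁻ x, ‖u (x + h) - u x‖ₑ ^ p) := by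
        have m1 : Measurable fun x => ‖u x‖ₑ ^ p := hu.enorm.measurable.pow_const p
        have m2 : Measurable fun x => ‖u (x + h)‖ₑ ^ p := m1.comp (measurable_add_const h)
        have m3 : Measurable fun x => ‖u (x + h) - u x‖ₑ ^ p :=
          (by fun_prop : Continuous fun x => u (x + h) - u x).enorm.measurable.pow_const p
        rw [lintegral_const_mul' _ _ ENNReal.ofReal_ne_top,
          lintegral_add_left (f := fun x => ‖u (x + h)‖ₑ ^ p + ‖u x‖ₑ ^ p) (m2.add m1),
          lintegral_add_left m2, lintegral_const_mul _ m3,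
          lintegral_add_right_eq_self (fun x => ‖u x‖ₑ ^ p) h, lintegral_enorm_rpow hp hup]
    _ ≤ ENNReal.ofReal ((p / 2 + 2) ^ 2 * t ^ 2) * (M + M +
          ENNReal.ofReal t⁻¹ ^ p * (ENNReal.ofReal t ^ p * M)) := by gcongr
    _ = ENNReal.ofReal ((p / 2 + 2) ^ 2 * t ^ 2) * (ENNReal.ofReal 3 * M) := by
        rw [← mul_assoc (_ ^ p), hcancel, one_mul]
        congr 1
        rw [show (3 : ℝ) = 1 + 1 + 1 by norm_num, ENNReal.ofReal_add (by norm_num) (by norm_num),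
          ENNReal.ofReal_add (by norm_num) (by norm_num), ENNReal.ofReal_one]
        ring
    _ = _ := by
        rw [← mul_assoc, ← ENNReal.ofReal_mul (by positivity), ht]
        congr 2
        ring

/-- A function annihilated by a low-pass filter is controlled by its differences. -/
theorem ofReal_integral_le_lintegral_halfPowerDifference (hp : 2 ≤ p) (hu : Continuous u)
    (hup : Integrable fun x => |u x| ^ p) {A₀ A₁ A₂ s : ℝ} (hs : 0 < s)
    {B : 𝓢(E, ℂ)} {k : 𝓢(E, ℝ)} (hk : IsLowPass A₀ A₁ A₂ s B k)
    (hann : ∀ x, ∫ y, k y * u (x - y) = 0) :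
    ENNReal.ofReal (∫ x, |u x| ^ p) ≤ ENNReal.ofReal (A₀ ^ (p - 1) * 2 ^ p) *
      ∫⁻ y, ‖k y‖ₑ * halfPowerDifference p u (-y) := by
  have hki := k.integrable (μ := (volume : Measure E))
  have hp0 : (0 : ℝ) ≤ p := by linarith
  have hA₀ : 0 ≤ A₀ := (integral_nonneg fun y => abs_nonneg _).trans hk.mass
  have hkui : ∀ x, Integrable fun y => k y * u (x - y) := fun x => by
    obtain ⟨w, hw, hw0, ⟨B, hB⟩, hwi, -, hkw, -, -⟩ := k.exists_weight le_rfl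
    refine (integrable_weight_mul hp hu hup hw hw0 hB hwi x).1.mono' (by fun_prop)
      (ae_of_all _ fun y => ?_)
    rw [norm_mul, Real.norm_eq_abs (u _)]
    gcongr
    simpa using hkw y 0 (by simp)
  -- the kernel has integral one and annihilates `u`
  have hrep : ∀ x, u x = ∫ y, k y * (u x - u (x - y)) := fun x => by
    simp_rw [mul_sub]
    rw [integral_sub (hki.mul_const _) (hkui x), hann, integral_mul_const, hk.integral_eq_one hs,
      one_mul, sub_zero]
  have hpt : ∀ y, ∫⁻ x, ‖u x - u (x - y)‖ₑ ^ p ≤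
      ENNReal.ofReal (2 ^ p) * halfPowerDifference p u (-y) := fun y => by
    rw [halfPowerDifference, ← lintegral_const_mul' _ _ ENNReal.ofReal_ne_top]
    refine lintegral_mono fun x => ?_
    rw [← ENNReal.ofReal_mul (by positivity), ← ofReal_norm,
      ENNReal.ofReal_rpow_of_nonneg (norm_nonneg _) hp0, Real.norm_eq_abs, abs_sub_comm,
      ← sub_eq_add_neg]
    exact ENNReal.ofReal_le_ofReal (abs_sub_rpow_le hp _ _)
  rw [← lintegral_enorm_rpow hp hup]
  calc ∫⁻ x, ‖u x‖ₑ ^ p = ∫⁻ x, ‖∫ y, k y * (u x - u (x - y))‖ₑ ^ p := by simp_rw [← hrep]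
    _ ≤ (∫⁻ y, ‖k y‖ₑ) ^ (p - 1) * ∫⁻ y, ‖k y‖ₑ * ∫⁻ x, ‖u x - u (x - y)‖ₑ ^ p :=
        lintegral_enorm_integral_mul_rpow_le (by linarith) k.continuous (by fun_prop)
    _ ≤ ENNReal.ofReal A₀ ^ (p - 1) * ∫⁻ y, ‖k y‖ₑ *
          (ENNReal.ofReal (2 ^ p) * halfPowerDifference p u (-y)) := by
        gcongr with y
        · linarith
        · exact lintegral_enorm_le_ofReal hki hk.mass
        · exact hpt y
    _ = _ := by
        simp_rw [mul_left_comm _ (ENNReal.ofReal (2 ^ p))]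
        rw [lintegral_const_mul' _ _ ENNReal.ofReal_ne_top, ← mul_assoc,
          ENNReal.ofReal_rpow_of_nonneg hA₀ (by linarith), ← ENNReal.ofReal_mul (by positivity)]

end Spectral

section Localisation

theorem lintegral_sin_sq_le {E : Type*} [NormedAddCommGroup E] [InnerProductSpace ℝ E]
    [MeasurableSpace E] [BorelSpace E] (μ : Measure E) (s : ℝ) (y : E) :
    ∫⁻ η, ENNReal.ofReal (4 * Real.sin (Real.pi * inner ℝ η y) ^ 2) ∂μ ≤
      4 * μ (Metric.ball 0 s)ᶜ + ENNReal.ofReal (4 * Real.pi ^ 2) * ENNReal.ofReal (‖y‖ ^ 2) *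
        ∫⁻ η in Metric.ball 0 s, ENNReal.ofReal (‖η‖ ^ 2) ∂μ := by
  have hball : MeasurableSet (Metric.ball (0 : E) s) := Metric.isOpen_ball.measurableSet
  rw [← lintegral_add_compl _ hball, add_comm]
  refine add_le_add ?_ ?_
  · refine (lintegral_mono (g := fun _ => (4 : ENNReal)) fun η => ?_).trans_eq
      (by rw [setLIntegral_const])
    refine ENNReal.ofReal_le_of_le_toReal ?_
    simpa using Real.abs_sin_le_one (Real.pi * inner ℝ η y)
  · rw [← lintegral_const_mul' _ _ (by finiteness)]
    refine lintegral_mono fun η => ?_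
    rw [← ENNReal.ofReal_mul (by positivity), ← ENNReal.ofReal_mul (by positivity)]
    refine ENNReal.ofReal_le_ofReal ?_
    have h1 : Real.sin (Real.pi * inner ℝ η y) ^ 2 ≤ (Real.pi * inner ℝ η y) ^ 2 :=
      sq_le_sq.2 Real.abs_sin_le_abs
    have h2 : (inner ℝ η y) ^ 2 ≤ (‖η‖ * ‖y‖) ^ 2 :=
      sq_le_sq.2 ((abs_real_inner_le_norm η y).trans (le_abs_self _))
    calc 4 * Real.sin (Real.pi * inner ℝ η y) ^ 2 ≤ 4 * (Real.pi ^ 2 * (inner ℝ η y) ^ 2) := by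
          rw [← mul_pow]; gcongr
      _ ≤ 4 * (Real.pi ^ 2 * (‖η‖ * ‖y‖) ^ 2) := by gcongr
      _ = _ := by ring

variable {E : Type*} [NormedAddCommGroup E] [InnerProductSpace ℝ E] [FiniteDimensional ℝ E]
  [MeasurableSpace E] [BorelSpace E]

theorem IsLowPass.lintegral_moment_le {A₀ A₁ A₂ s : ℝ} {B : 𝓢(E, ℂ)} {k : 𝓢(E, ℝ)}
    (hk : IsLowPass A₀ A₁ A₂ s B k) :
    ∫⁻ y, ‖k y‖ₑ * ENNReal.ofReal (‖y‖ ^ 2) ≤ ENNReal.ofReal (A₂ / s ^ 2) := by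
  have h := ENNReal.ofReal_le_ofReal hk.moment
  rw [ofReal_integral_eq_lintegral_ofReal hk.integrable_moment
    (ae_of_all _ fun y => by positivity)] at h
  refine le_of_eq_of_le (lintegral_congr fun y => ?_) h
  rw [ENNReal.ofReal_mul (abs_nonneg _), ← Real.norm_eq_abs, ofReal_norm]

/-- The mass of the spectral measure outside a ball is bounded by the second differences averaged by
the low-pass filter of half that radius. -/
theorem two_mul_measure_compl_ball_le {μ : Measure E} [IsFiniteMeasure μ] {A₀ A₁ A₂ s : ℝ}
    (hs : 0 < s) {B : 𝓢(E, ℂ)} {k : 𝓢(E, ℝ)} (hk : IsLowPass A₀ A₁ A₂ (s / 2) B k) :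
    2 * μ (Metric.ball 0 s)ᶜ ≤ ∫⁻ y, ‖k y‖ₑ *
      ∫⁻ η, ENNReal.ofReal (4 * Real.sin (Real.pi * inner ℝ η y) ^ 2) ∂μ := by
  have hm : Measurable fun q : E × E =>
      ‖k q.2‖ₑ * ENNReal.ofReal (4 * Real.sin (Real.pi * inner ℝ q.1 q.2) ^ 2) :=
    (k.continuous.comp continuous_snd).enorm.measurable.mul
      (by fun_prop : Continuous fun q : E × E =>
        4 * Real.sin (Real.pi * inner ℝ q.1 q.2) ^ 2).measurable.ennreal_ofReal
  have hball : MeasurableSet (Metric.ball (0 : E) s)ᶜ := Metric.isOpen_ball.measurableSet.compl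
  have hlow : ∀ η ∈ (Metric.ball (0 : E) s)ᶜ, (2 : ENNReal) ≤
      ∫⁻ y, ‖k y‖ₑ * ENNReal.ofReal (4 * Real.sin (Real.pi * inner ℝ η y) ^ 2) := by
    intro η hη
    have hη' : 2 * (s / 2) ≤ ‖η‖ := by
      rw [mul_div_cancel₀ s two_ne_zero]
      simpa using hη
    have h := enorm_integral_le_lintegral_enorm (μ := (volume : Measure E))
      fun y => k y * (4 * Real.sin (Real.pi * inner ℝ η y) ^ 2)
    rw [hk.integral_mul_sin_sq (by positivity) hη'] at h
    have h2 : ‖(2 : ℝ)‖ₑ = 2 := by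
      rw [Real.enorm_eq_ofReal zero_le_two, ENNReal.ofReal_ofNat]
    rw [h2] at h
    refine h.trans_eq (lintegral_congr fun y => ?_)
    rw [enorm_mul, Real.enorm_eq_ofReal (by positivity : 0 ≤ 4 * Real.sin _ ^ 2)]
  calc 2 * μ (Metric.ball 0 s)ᶜ = ∫⁻ _ in (Metric.ball (0 : E) s)ᶜ, 2 ∂μ := by
        rw [setLIntegral_const]
    _ ≤ ∫⁻ η in (Metric.ball (0 : E) s)ᶜ, (∫⁻ y, ‖k y‖ₑ *
          ENNReal.ofReal (4 * Real.sin (Real.pi * inner ℝ η y) ^ 2)) ∂μ :=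
        setLIntegral_mono' hball hlow
    _ ≤ ∫⁻ η, (∫⁻ y, ‖k y‖ₑ * ENNReal.ofReal (4 * Real.sin (Real.pi * inner ℝ η y) ^ 2)) ∂μ :=
        setLIntegral_le_lintegral _ _
    _ = ∫⁻ y, ∫⁻ η, ‖k y‖ₑ * ENNReal.ofReal (4 * Real.sin (Real.pi * inner ℝ η y) ^ 2) ∂μ :=
        lintegral_lintegral_swap hm.aemeasurable
    _ = _ := by
        refine lintegral_congr fun y => ?_
        rw [lintegral_const_mul' _ _ enorm_ne_top]

/-- The half power of a function with spectrum in an annulus of size `l` keeps a fixed proportion of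
its mass at frequencies comparable to `l`. -/
theorem exists_spectral_localisation {p A₀ A₁ A₂ : ℝ} (hp : 2 ≤ p) (hA₀ : 0 ≤ A₀) (hA₁ : 0 ≤ A₁)
    (hA₂ : 0 ≤ A₂)
    (hA : ∀ s : ℝ, 0 < s → ∃ (B : 𝓢(E, ℂ)) (k : 𝓢(E, ℝ)), IsLowPass A₀ A₁ A₂ s B k) :
    ∃ S C : ℝ, 1 ≤ S ∧ 0 < C ∧ ∀ (l : ℝ), 0 < l → ∀ (u : E → ℝ), Continuous u →
      Integrable (fun x => |u x| ^ p) →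
      ∀ (B B' : 𝓢(E, ℂ)) (k k' : 𝓢(E, ℝ)), IsLowPass A₀ A₁ A₂ l B k →
      IsLowPass A₀ A₁ A₂ (l / 32) B' k' → (∀ x, u x = ∫ y, k y * u (x - y)) →
      (∀ x, ∫ y, k' y * u (x - y) = 0) →
      ∀ μ : Measure E, μ Set.univ = ENNReal.ofReal (∫ x, |u x| ^ p) →
      (∀ h, halfPowerDifference p u h =
        ∫⁻ η, ENNReal.ofReal (4 * Real.sin (Real.pi * inner ℝ η h) ^ 2) ∂μ) →
      ENNReal.ofReal (l ^ 2 * ∫ x, |u x| ^ p) ≤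
        ENNReal.ofReal C * ∫⁻ η in Metric.ball 0 (S * l), ENNReal.ofReal (‖η‖ ^ 2) ∂μ := by
  set Cb : ℝ := 3 * (p / 2 + 2) ^ 2 * (A₁ + 1) ^ 2 with hCb
  set Ca : ℝ := A₀ ^ (p - 1) * 2 ^ p with hCa
  have hCb0 : 0 ≤ Cb := by positivity
  have hCa0 : 0 ≤ Ca := by positivity
  -- `S` is so large that the mass beyond `S * l` can be absorbed into half of the total mass
  set S : ℝ := 1 + 16 * Ca * A₀ * Cb * A₂ with hS
  have hS1 : 1 ≤ S := by
    have : 0 ≤ 16 * Ca * A₀ * Cb * A₂ := by positivity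
    linarith
  set D : ℝ := 4096 * Real.pi ^ 2 * A₂ with hD
  have hD0 : 0 ≤ D := by positivity
  refine ⟨S, 2 * Ca * D + 1, hS1, by positivity,
    fun l hl u hu hup B B' k k' hk hk' hrep hann μ hμ hN => ?_⟩
  set M := ∫ x, |u x| ^ p with hM
  have hM0 : 0 ≤ M := integral_nonneg fun x => by positivity
  have hfin : IsFiniteMeasure μ := ⟨by rw [hμ]; exact ENNReal.ofReal_lt_top⟩
  have hSl : 0 < S * l := by positivity
  set Q := ∫⁻ η in Metric.ball 0 (S * l), ENNReal.ofReal (‖η‖ ^ 2) ∂μ with hQ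
  have hQfin : Q ≠ ⊤ := by
    have : Q ≤ ∫⁻ _ in Metric.ball (0 : E) (S * l), ENNReal.ofReal ((S * l) ^ 2) ∂μ := by
      refine setLIntegral_mono' Metric.isOpen_ball.measurableSet fun η hη => ?_
      have : ‖η‖ < S * l := by simpa using hη
      gcongr
    rw [setLIntegral_const] at this
    exact ne_top_of_le_ne_top (by finiteness) this
  -- Chebyshev's inequality at high frequencies, from the Bernstein bound on the half power
  have hhigh : 2 * μ (Metric.ball 0 (S * l))ᶜ ≤ ENNReal.ofReal (4 * Cb * A₂ / S ^ 2 * M) := by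
    obtain ⟨B₂, k₂, hk₂⟩ := hA (S * l / 2) (by positivity)
    refine (two_mul_measure_compl_ball_le hSl hk₂).trans ?_
    calc ∫⁻ y, ‖k₂ y‖ₑ * ∫⁻ η, ENNReal.ofReal (4 * Real.sin (Real.pi * inner ℝ η y) ^ 2) ∂μ
        ≤ ∫⁻ y, (ENNReal.ofReal (Cb * l ^ 2) * ENNReal.ofReal M) *
            (‖k₂ y‖ₑ * ENNReal.ofReal (‖y‖ ^ 2)) := by
          refine lintegral_mono fun y => ?_
          have h1 := halfPowerDifference_le hp hu hup hA₁ hl hk hrep y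
          rw [hN y, ENNReal.ofReal_mul (by positivity)] at h1
          refine (mul_le_mul_right h1 _).trans_eq ?_
          rw [hCb]
          ring
      _ ≤ (ENNReal.ofReal (Cb * l ^ 2) * ENNReal.ofReal M) *
            ENNReal.ofReal (A₂ / (S * l / 2) ^ 2) := by
          rw [lintegral_const_mul' _ _ (by finiteness)]
          gcongr
          exact hk₂.lintegral_moment_le
      _ = _ := by
          rw [← ENNReal.ofReal_mul (by positivity), ← ENNReal.ofReal_mul (by positivity)]
          congr 1
          field_simp
          ring
  -- the vanishing of `u` at low frequencies
  have hlow : ENNReal.ofReal M ≤ ENNReal.ofReal Ca *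
      (ENNReal.ofReal A₀ * (2 * (2 * μ (Metric.ball 0 (S * l))ᶜ)) +
        ENNReal.ofReal (D / l ^ 2) * Q) := by
    refine (ofReal_integral_le_lintegral_halfPowerDifference hp hu hup (by positivity)
      hk' hann).trans ?_
    gcongr
    calc ∫⁻ y, ‖k' y‖ₑ * halfPowerDifference p u (-y)
        ≤ ∫⁻ y, (‖k' y‖ₑ * (4 * μ (Metric.ball 0 (S * l))ᶜ) +
            (ENNReal.ofReal (4 * Real.pi ^ 2) * Q) * (‖k' y‖ₑ * ENNReal.ofReal (‖y‖ ^ 2))) := by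
          refine lintegral_mono fun y => ?_
          rw [hN]
          refine (mul_le_mul_right (lintegral_sin_sq_le μ (S * l) (-y)) _).trans_eq ?_
          rw [norm_neg]
          ring
      _ = (∫⁻ y, ‖k' y‖ₑ) * (4 * μ (Metric.ball 0 (S * l))ᶜ) +
            (ENNReal.ofReal (4 * Real.pi ^ 2) * Q) *
              ∫⁻ y, ‖k' y‖ₑ * ENNReal.ofReal (‖y‖ ^ 2) := by
          have m1 : Measurable fun y => ‖k' y‖ₑ := k'.continuous.enorm.measurable
          rw [lintegral_add_left (m1.mul_const _), lintegral_mul_const _ m1,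
            lintegral_const_mul' _ _ (by finiteness)]
      _ ≤ ENNReal.ofReal A₀ * (4 * μ (Metric.ball 0 (S * l))ᶜ) +
            (ENNReal.ofReal (4 * Real.pi ^ 2) * Q) * ENNReal.ofReal (A₂ / (l / 32) ^ 2) := by
          gcongr
          · exact lintegral_enorm_le_ofReal k'.integrable hk'.mass
          · exact hk'.lintegral_moment_le
      _ = _ := by
          congr 1
          · ring
          · rw [mul_right_comm, ← ENNReal.ofReal_mul (by positivity)]
            congr 2
            rw [hD]
            field_simp
            ring
  have hQr : Q = ENNReal.ofReal Q.toReal := (ENNReal.ofReal_toReal hQfin).symm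
  set q := Q.toReal with hq
  have hq0 : 0 ≤ q := ENNReal.toReal_nonneg
  have hreal : M ≤ Ca * (A₀ * (2 * (4 * Cb * A₂ / S ^ 2 * M)) + D / l ^ 2 * q) := by
    have h2 : (2 : ENNReal) = ENNReal.ofReal 2 := by simp
    have h1 := hlow.trans (mul_le_mul_right (add_le_add (mul_le_mul_right
      (mul_le_mul_right hhigh 2) (ENNReal.ofReal A₀)) le_rfl) (ENNReal.ofReal Ca))
    rw [hQr, h2, ← ENNReal.ofReal_mul (by positivity), ← ENNReal.ofReal_mul (by positivity),
      ← ENNReal.ofReal_mul (by positivity), ← ENNReal.ofReal_add (by positivity) (by positivity),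
      ← ENNReal.ofReal_mul (by positivity)] at h1
    exact (ENNReal.ofReal_le_ofReal_iff (by positivity)).1 h1
  have habs : Ca * (A₀ * (2 * (4 * Cb * A₂ / S ^ 2 * M))) ≤ M / 2 := by
    have h1 : Ca * (A₀ * (2 * (4 * Cb * A₂ / S ^ 2 * M))) =
        (16 * Ca * A₀ * Cb * A₂) / S ^ 2 * (M / 2) := by ring
    rw [h1]
    refine mul_le_of_le_one_left (by positivity) ?_
    rw [div_le_one (by positivity)]
    nlinarith
  have hfinal : l ^ 2 * M ≤ (2 * Ca * D + 1) * q := by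
    have h1 : M / 2 ≤ Ca * (D / l ^ 2 * q) := by linarith
    have h2 : l ^ 2 * (M / 2) ≤ l ^ 2 * (Ca * (D / l ^ 2 * q)) := by gcongr
    have h3 : l ^ 2 * (Ca * (D / l ^ 2 * q)) = Ca * D * q := by field_simp
    linarith
  rw [hQr, ← ENNReal.ofReal_mul (by positivity)]
  exact ENNReal.ofReal_le_ofReal hfinal

end Localisation

/-! ### Averaging over the Lévy measure -/

section Levy

variable {d : ℕ} {ν : Measure (Rd d)} {σ : Rd d →L[ℝ] Rd d}

theorem norm_le_norm_adjoint {Λ : ℝ} (hΛ : 1 ≤ Λ) (hσ : ∀ ξ, Λ⁻¹ * ‖ξ‖ ≤ ‖σ ξ‖) (η : Rd d) :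
    ‖η‖ ≤ Λ * ‖ContinuousLinearMap.adjoint σ η‖ := by
  have hΛ0 : 0 < Λ := by linarith
  have hinj : Function.Injective (σ : Rd d →ₗ[ℝ] Rd d) := by
    rw [← LinearMap.ker_eq_bot, LinearMap.ker_eq_bot']
    intro ξ hξ
    have h := hσ ξ
    have h0 : σ ξ = 0 := hξ
    rw [h0, norm_zero] at h
    have : 0 < Λ⁻¹ := by positivity
    exact norm_le_zero_iff.1 (by nlinarith [norm_nonneg ξ])
  obtain ⟨ζ, hζ⟩ := LinearMap.injective_iff_surjective.1 hinj η
  have hζ' : σ ζ = η := hζ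
  have h1 : ‖ζ‖ ≤ Λ * ‖η‖ := by
    have := hσ ζ
    rw [hζ', inv_mul_le_iff₀ hΛ0] at this
    exact this
  have h2 : ‖η‖ ^ 2 ≤ ‖ζ‖ * ‖ContinuousLinearMap.adjoint σ η‖ := by
    rw [← real_inner_self_eq_norm_sq]
    nth_rw 1 [← hζ']
    rw [← ContinuousLinearMap.adjoint_inner_right]
    exact real_inner_le_norm _ _
  rcases (norm_nonneg η).eq_or_lt with h | h
  · rw [← h]; positivity
  · have h3 : ‖ζ‖ * ‖ContinuousLinearMap.adjoint σ η‖ ≤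
        Λ * ‖η‖ * ‖ContinuousLinearMap.adjoint σ η‖ := by gcongr
    nlinarith

theorem LevyLowerBound.le_lintegral {α c₀ ρ r Λ : ℝ} (hν : LevyLowerBound ν α c₀ ρ)
    (hr : r ∈ Set.Ioo 0 ρ) (hc₀ : 0 ≤ c₀) (hΛ : 1 ≤ Λ) (hσ : ∀ ξ, Λ⁻¹ * ‖ξ‖ ≤ ‖σ ξ‖) (η : Rd d) :
    ENNReal.ofReal (c₀ * r ^ (2 - α) / Λ ^ 2) * ENNReal.ofReal (‖η‖ ^ 2) ≤
      ∫⁻ z in Metric.ball 0 r, ENNReal.ofReal ((inner ℝ η (σ z)) ^ 2) ∂ν := by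
  set ζ := ContinuousLinearMap.adjoint σ η with hζ
  have hηζ : ‖η‖ ≤ Λ * ‖ζ‖ := norm_le_norm_adjoint hΛ hσ η
  have hr0 : 0 ≤ r ^ (2 - α) := Real.rpow_nonneg hr.1.le _
  rcases eq_or_ne ζ 0 with h0 | h0
  · have : ‖η‖ = 0 := le_antisymm (by simpa [h0] using hηζ) (norm_nonneg _)
    simp [this]
  have hζ0 : 0 < ‖ζ‖ := norm_pos_iff.2 h0
  set θ := ‖ζ‖⁻¹ • ζ with hθ
  have hθ1 : ‖θ‖ = 1 := by
    rw [hθ, norm_smul, norm_inv, norm_norm, inv_mul_cancel₀ hζ0.ne']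
  have h1 := hν r hr θ hθ1
  -- no integrability is needed here: the real integral never exceeds the extended one
  rw [integral_eq_lintegral_of_nonneg_ae (ae_of_all _ fun z => sq_nonneg _)
    (by fun_prop)] at h1
  have h2 := (ENNReal.ofReal_le_ofReal h1).trans ENNReal.ofReal_toReal_le
  have h3 : ∀ z, ENNReal.ofReal ((inner ℝ η (σ z)) ^ 2) =
      ENNReal.ofReal (‖ζ‖ ^ 2) * ENNReal.ofReal ((inner ℝ θ z) ^ 2) := fun z => by
    rw [← ENNReal.ofReal_mul (by positivity), ← ContinuousLinearMap.adjoint_inner_left, ← hζ, hθ,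
      real_inner_smul_left]
    congr 1
    field_simp
  simp_rw [h3]
  rw [lintegral_const_mul' _ _ (by finiteness)]
  refine le_trans ?_ (mul_le_mul_right h2 _)
  rw [← ENNReal.ofReal_mul (by positivity), ← ENNReal.ofReal_mul (by positivity)]
  refine ENNReal.ofReal_le_ofReal ?_
  have h4 : ‖η‖ ^ 2 ≤ Λ ^ 2 * ‖ζ‖ ^ 2 := by
    rw [← mul_pow]
    gcongr
  calc c₀ * r ^ (2 - α) / Λ ^ 2 * ‖η‖ ^ 2 ≤ c₀ * r ^ (2 - α) / Λ ^ 2 * (Λ ^ 2 * ‖ζ‖ ^ 2) := by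
        gcongr
    _ = _ := by
        have : Λ ≠ 0 := by linarith
        field_simp

/-- The lower bound on the small jumps, integrated against a spectral measure: on the ball of radius
`s` the increments `σ z` with `‖z‖ < 1 / (2 Λ s)` do not complete half an oscillation. -/
theorem le_lintegral_lintegral_sin_sq [SigmaFinite ν] {μ : Measure (Rd d)} [IsFiniteMeasure μ]
    {α c₀ ρ r Λ s : ℝ} (hν : LevyLowerBound ν α c₀ ρ) (hr : r ∈ Set.Ioo 0 ρ) (hc₀ : 0 ≤ c₀)
    (hΛ : 1 ≤ Λ) (hσ : ∀ ξ, Λ⁻¹ * ‖ξ‖ ≤ ‖σ ξ‖ ∧ ‖σ ξ‖ ≤ Λ * ‖ξ‖) (hs : 0 < s)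
    (hrs : 2 * Λ * s * r ≤ 1) :
    ENNReal.ofReal (16 * (c₀ * r ^ (2 - α) / Λ ^ 2)) *
        ∫⁻ η in Metric.ball 0 s, ENNReal.ofReal (‖η‖ ^ 2) ∂μ ≤
      ∫⁻ z, ∫⁻ η, ENNReal.ofReal (4 * Real.sin (Real.pi * inner ℝ η (σ z)) ^ 2) ∂μ ∂ν := by
  have hr0 : 0 ≤ r ^ (2 - α) := Real.rpow_nonneg hr.1.le _
  have hm : Measurable fun q : Rd d × Rd d =>
      ENNReal.ofReal (4 * Real.sin (Real.pi * inner ℝ q.1 (σ q.2)) ^ 2) :=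
    (by fun_prop : Continuous fun q : Rd d × Rd d =>
      4 * Real.sin (Real.pi * inner ℝ q.1 (σ q.2)) ^ 2).measurable.ennreal_ofReal
  have hsin : ∀ η ∈ Metric.ball (0 : Rd d) s, ∀ z ∈ Metric.ball (0 : Rd d) r,
      16 * (inner ℝ η (σ z)) ^ 2 ≤ 4 * Real.sin (Real.pi * inner ℝ η (σ z)) ^ 2 := by
    intro η hη z hz
    have hη' : ‖η‖ ≤ s := (mem_ball_zero_iff.1 hη).le
    have hz' : ‖z‖ ≤ r := (mem_ball_zero_iff.1 hz).le
    set a := inner ℝ η (σ z) with ha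
    have h1 : |a| ≤ 1 / 2 := by
      have hσz : ‖σ z‖ ≤ Λ * r := (hσ z).2.trans (by gcongr)
      have : |a| ≤ s * (Λ * r) := (abs_real_inner_le_norm _ _).trans (by gcongr)
      linarith
    have h2 := Real.mul_le_sin (x := Real.pi * |a|) (by positivity)
      (by nlinarith [Real.pi_pos])
    have h3 : 2 / Real.pi * (Real.pi * |a|) = 2 * |a| := by field_simp
    rw [h3] at h2
    have h4 : Real.sin (Real.pi * |a|) ^ 2 = Real.sin (Real.pi * a) ^ 2 := by
      rcases abs_choice a with h | h <;> rw [h]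
      rw [mul_neg, Real.sin_neg, neg_sq]
    have h5 := pow_le_pow_left₀ (by positivity) h2 2
    rw [h4, mul_pow, sq_abs] at h5
    linarith
  calc ENNReal.ofReal (16 * (c₀ * r ^ (2 - α) / Λ ^ 2)) *
        ∫⁻ η in Metric.ball 0 s, ENNReal.ofReal (‖η‖ ^ 2) ∂μ
      = ∫⁻ η in Metric.ball 0 s, ENNReal.ofReal 16 *
          (ENNReal.ofReal (c₀ * r ^ (2 - α) / Λ ^ 2) * ENNReal.ofReal (‖η‖ ^ 2)) ∂μ := by
        rw [← lintegral_const_mul' _ _ (by finiteness)]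
        refine lintegral_congr fun η => ?_
        rw [ENNReal.ofReal_mul (by norm_num), mul_assoc]
    _ ≤ ∫⁻ η in Metric.ball 0 s, ENNReal.ofReal 16 *
          ∫⁻ z in Metric.ball 0 r, ENNReal.ofReal ((inner ℝ η (σ z)) ^ 2) ∂ν ∂μ := by
        refine lintegral_mono fun η => ?_
        gcongr
        exact hν.le_lintegral hr hc₀ hΛ (fun ξ => (hσ ξ).1) η
    _ ≤ ∫⁻ η in Metric.ball 0 s, ∫⁻ z in Metric.ball 0 r,
          ENNReal.ofReal (4 * Real.sin (Real.pi * inner ℝ η (σ z)) ^ 2) ∂ν ∂μ := by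
        refine setLIntegral_mono' Metric.isOpen_ball.measurableSet fun η hη => ?_
        rw [← lintegral_const_mul' _ _ (by finiteness)]
        refine setLIntegral_mono' Metric.isOpen_ball.measurableSet fun z hz => ?_
        rw [← ENNReal.ofReal_mul (by norm_num)]
        exact ENNReal.ofReal_le_ofReal (hsin η hη z hz)
    _ ≤ ∫⁻ η, ∫⁻ z, ENNReal.ofReal (4 * Real.sin (Real.pi * inner ℝ η (σ z)) ^ 2) ∂ν ∂μ :=
        (setLIntegral_le_lintegral _ _).trans
          (lintegral_mono fun η => setLIntegral_le_lintegral _ _)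
    _ = _ := lintegral_lintegral_swap hm.aemeasurable

theorem halfPowerDifference_le_differenceEnergy {p : ℝ} {u : Rd d → ℝ} (hp : 2 ≤ p)
    (hu : Continuous u) (hup : Integrable fun x => |u x| ^ p) (h : Rd d) :
    halfPowerDifference p u h ≤
      ENNReal.ofReal (2 * (p / 2 + 2) ^ 2) * ENNReal.ofReal (differenceEnergy p u h) := by
  rw [differenceEnergy, ofReal_integral_eq_lintegral_ofReal (integrable_differenceEnergy hp hu hup h)
    (ae_of_all _ fun x => signedPow_sub_mul_nonneg hp _ _),
    ← lintegral_const_mul' _ _ ENNReal.ofReal_ne_top]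
  refine lintegral_mono fun x => ?_
  rw [← ENNReal.ofReal_mul (by positivity)]
  exact ENNReal.ofReal_le_ofReal (sq_signedPow_sub_le hp _ _)

end Levy

/-! ### The Bernstein-type inequality -/

theorem lemma3p1 (d : ℕ) (hd : 0 < d) (p : ℝ) (hp : 2 ≤ p) (c₀ ρ Λ : ℝ)
    (hc₀ : c₀ ∈ Set.Ioo (0 : ℝ) 1) (hρ : ρ ∈ Set.Ioo (0 : ℝ) 1) (hΛ : 1 ≤ Λ) :
    ∃ c : ℝ, 0 < c ∧ ∃ j₀ : ℕ,
      ∀ (α : ℝ), α ∈ Set.Ioo (0 : ℝ) 2 →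
      ∀ (χ : Rd d → ℝ), IsRadialCutoff χ →
      ∀ (ν : Measure (Rd d)), IsLevyMeasure ν → IsSymmetricMeasure ν → LevyLowerBound ν α c₀ ρ →
      ∀ (σ : Rd d →L[ℝ] Rd d), (∀ ξ, Λ⁻¹ * ‖ξ‖ ≤ ‖σ ξ‖ ∧ ‖σ ξ‖ ≤ Λ * ‖ξ‖) →
      ∀ (f : 𝓢'(Rd d, ℂ)) (j : ℤ), -1 ≤ j →
      ∀ (u : Rd d → ℝ), IsContinuousLpFunction (dyadicBlock χ j f) p u →
        -- the integrals below are meaningful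
        (Differentiable ℝ u ∧ (∀ x, Integrable (levyIntegrand σ u x) ν) ∧
          Integrable (energyDensity ν σ p u) volume) ∧
        (∫ x, energyDensity ν σ p u x) ≤ 0 ∧
        ((j₀ : ℤ) ≤ j →
          c * (2 : ℝ) ^ (α * (j : ℝ)) * (eLpNorm u (ENNReal.ofReal p) volume).toReal ^ p ≤
            -∫ x, energyDensity ν σ p u x) := by
  have hΛ0 : 0 < Λ := by linarith
  obtain ⟨A₀, A₁, A₂, hA₀, hA₁, hA₂, hA⟩ := exists_isLowPass (Rd d)
  obtain ⟨S, C, hS, hC, hloc⟩ := exists_spectral_localisation hp hA₀ hA₁ hA₂ hA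
  set K : ℝ := 2 * (p / 2 + 2) ^ 2 with hK
  have hK0 : 0 < K := by positivity
  -- `j₀` only has to make the radius `r` below smaller than `ρ`
  obtain ⟨j₀, hj₀⟩ := pow_unbounded_of_one_lt (ρ⁻¹) (one_lt_two : (1 : ℝ) < 2)
  refine ⟨16 * c₀ / Λ ^ 2 / (2 * Λ * S) ^ 2 / (2 * C * K), by have := hc₀.1; positivity, j₀, ?_⟩
  intro α hα χ hχ ν hν hsym hlow σ hσ f j hj u hu
  have := hν.sigmaFinite
  have hup := hu.integrable_rpow hp
  have hl : (0 : ℝ) < 2 ^ j := by positivity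
  obtain ⟨B, k, hk⟩ := hA _ hl
  have hrep := eq_integral_lowPass hχ hj hp hu hk le_rfl
  obtain ⟨hdiff, hlevy, hdens, hEi, hen⟩ := energy_identity hp hu.continuous hup k hrep hν hsym hΛ
    fun z => (hσ z).2
  have hE0 : 0 ≤ ∫ z, differenceEnergy p u (σ z) ∂ν :=
    integral_nonneg fun z => differenceEnergy_nonneg hp _
  refine ⟨⟨hdiff, hlevy, hdens⟩, by linarith, fun hjj => ?_⟩
  set M := ∫ x, |u x| ^ p with hM
  have hM0 : 0 ≤ M := integral_nonneg fun x => by positivity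
  have hnorm : (eLpNorm u (ENNReal.ofReal p) volume).toReal ^ p = M := by
    have hp0 : 0 < p := by linarith
    rw [eLpNorm_eq_lintegral_rpow_enorm_toReal (by simpa using hp0) ENNReal.ofReal_ne_top,
      ENNReal.toReal_ofReal hp0.le, lintegral_enorm_rpow hp hup, ENNReal.toReal_rpow,
      ← ENNReal.rpow_mul, one_div_mul_cancel hp0.ne', ENNReal.rpow_one, ENNReal.toReal_ofReal hM0]
  set l : ℝ := 2 ^ j with hldef
  obtain ⟨B', k', hk'⟩ := hA (l / 32) (by positivity)
  have hann := integral_lowPass_eq_zero hχ (by omega) hp hu hk' (by linarith)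
  have hsq : ∀ x, signedPow (p / 2) (u x) ^ 2 = |u x| ^ p := fun x => signedPow_sq hp _
  obtain ⟨μ, hμ, hN⟩ := exists_spectral_measure
    ((continuous_signedPow (q := p / 2) (by linarith)).comp hu.continuous)
    (by simpa only [Function.comp_apply, hsq] using hup)
  simp only [Function.comp_apply, hsq] at hμ hN
  have hfin : IsFiniteMeasure μ := ⟨by rw [hμ]; exact ENNReal.ofReal_lt_top⟩
  have hspec := hloc l hl u hu.continuous hup B B' k k' hk hk' hrep hann μ hμ hN
  -- the radius below which the increments `σ z` resolve the frequencies up to `S * l`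
  set r : ℝ := (2 * Λ * S * l)⁻¹ with hrdef
  have hr0 : 0 < r := by positivity
  have hrρ : r < ρ := by
    have h1 : (2 : ℝ) ^ j₀ ≤ l := by
      rw [hldef, ← zpow_natCast]
      exact zpow_le_zpow_right₀ one_le_two hjj
    rw [hrdef, inv_lt_comm₀ (by positivity) hρ.1]
    have h2 : 1 ≤ 2 * Λ * S := by nlinarith
    calc ρ⁻¹ < 2 ^ j₀ := hj₀
      _ ≤ l := h1
      _ ≤ 2 * Λ * S * l := le_mul_of_one_le_left hl.le h2
  have hc₀0 : 0 ≤ c₀ := hc₀.1.le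
  have hlev := le_lintegral_lintegral_sin_sq (μ := μ) hlow ⟨hr0, hrρ⟩ hc₀0 hΛ hσ
    (s := S * l) (by positivity) (by rw [hrdef]; field_simp; exact le_rfl)
  set G : ℝ := 16 * (c₀ * r ^ (2 - α) / Λ ^ 2) with hG
  have hG0 : 0 ≤ G := by positivity
  have hEK : ∫⁻ z, ∫⁻ η, ENNReal.ofReal (4 * Real.sin (Real.pi * inner ℝ η (σ z)) ^ 2) ∂μ ∂ν ≤
      ENNReal.ofReal (K * ∫ z, differenceEnergy p u (σ z) ∂ν) := by
    rw [ENNReal.ofReal_mul hK0.le, ofReal_integral_eq_lintegral_ofReal hEi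
      (ae_of_all _ fun z => differenceEnergy_nonneg hp _),
      ← lintegral_const_mul' _ _ ENNReal.ofReal_ne_top]
    refine lintegral_mono fun z => ?_
    rw [← hN (σ z)]
    exact halfPowerDifference_le_differenceEnergy hp hu.continuous hup (σ z)
  have hmain : G * (l ^ 2 * M) ≤ C * (K * ∫ z, differenceEnergy p u (σ z) ∂ν) := by
    refine (ENNReal.ofReal_le_ofReal_iff (by positivity)).1 ?_
    rw [ENNReal.ofReal_mul hG0, ENNReal.ofReal_mul hC.le]
    calc ENNReal.ofReal G * ENNReal.ofReal (l ^ 2 * M)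
        ≤ ENNReal.ofReal G * (ENNReal.ofReal C *
            ∫⁻ η in Metric.ball 0 (S * l), ENNReal.ofReal (‖η‖ ^ 2) ∂μ) := by gcongr
      _ = ENNReal.ofReal C * (ENNReal.ofReal G *
            ∫⁻ η in Metric.ball 0 (S * l), ENNReal.ofReal (‖η‖ ^ 2) ∂μ) := mul_left_comm _ _ _
      _ ≤ _ := mul_le_mul_right (hlev.trans hEK) _
  -- replacing the exponent `α - 2` of `2 Λ S ≥ 1` by `-2` makes the constant independent of `α`
  have hpow : l ^ α * ((2 * Λ * S) ^ 2)⁻¹ ≤ r ^ (2 - α) * l ^ 2 := by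
    have hT : 1 ≤ 2 * Λ * S := by nlinarith
    have h1 : r ^ (2 - α) = (2 * Λ * S) ^ (α - 2) * l ^ (α - 2) := by
      rw [hrdef, ← Real.rpow_neg_one, ← Real.rpow_mul (by positivity),
        Real.mul_rpow (by positivity) hl.le]
      congr 2 <;> ring
    have h2 : l ^ (α - 2) * l ^ 2 = l ^ α := by
      rw [← Real.rpow_natCast, ← Real.rpow_add hl]
      congr 1
      push_cast
      ring
    have h3 : ((2 * Λ * S) ^ 2)⁻¹ ≤ (2 * Λ * S) ^ (α - 2) := by
      rw [← Real.rpow_natCast, ← Real.rpow_neg (by positivity)]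
      exact Real.rpow_le_rpow_of_exponent_le hT (by push_cast; linarith [hα.1])
    rw [h1, mul_assoc (_ ^ (α - 2)), h2, mul_comm]
    gcongr
  have hlα : (2 : ℝ) ^ (α * (j : ℝ)) = l ^ α := by
    rw [hldef, mul_comm, Real.rpow_mul zero_le_two, Real.rpow_intCast]
  rw [hnorm, hlα]
  have hI : ∫ z, differenceEnergy p u (σ z) ∂ν = 2 * -∫ x, energyDensity ν σ p u x := by linarith
  rw [hI] at hmain
  have hfinal : 16 * c₀ / Λ ^ 2 * (l ^ α * ((2 * Λ * S) ^ 2)⁻¹) * M ≤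
      2 * C * K * -∫ x, energyDensity ν σ p u x := by
    calc 16 * c₀ / Λ ^ 2 * (l ^ α * ((2 * Λ * S) ^ 2)⁻¹) * M
        ≤ 16 * c₀ / Λ ^ 2 * (r ^ (2 - α) * l ^ 2) * M := by gcongr
      _ = G * (l ^ 2 * M) := by rw [hG]; ring
      _ ≤ _ := hmain
      _ = _ := by ring
  calc 16 * c₀ / Λ ^ 2 / (2 * Λ * S) ^ 2 / (2 * C * K) * l ^ α * M
      = (16 * c₀ / Λ ^ 2 * (l ^ α * ((2 * Λ * S) ^ 2)⁻¹) * M) / (2 * C * K) := by ring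
    _ ≤ _ := by
      rw [div_le_iff₀ (by positivity)]
      linarith
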